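/- **Setting.** A *superform* on $\mathbb R^n$ is a form $a=\sum_{I,J}a_{IJ}(x)\,dx_I\wedge d\xi_J$ on $\mathbb R^n_x\oplus\mathbb R^n_\xi$ whose coefficients depend only on $x$; put $da=\sum_k dx_k\wedge\partial a/\partial x_k$, let $J$ (also written $a^\#=J(a)$) be the multiplicative map with $J(dx_i)=d\xi_i$, $J(d\xi_i)=-dx_i$, and let $\beta=\sum_i dx_i\wedge d\xi_i$. For an open set $\Omega\subseteq\mathbb R^n$, a *supercurrent* on $\Omega$ is a continuous linear functional on the smooth superforms with compact support in $\Omega$; put $(T\wedge\alpha).\varphi=T.(\alpha\wedge\varphi)$ and $dT.\varphi=(-1)^{k+1}\,T.d\varphi$ if $T$ has total degree $k$. Let $1\le m\le n$, $p=n-m$, and let $M$ be a smooth embedded $m$-dimensional submanifold of $\Omega$ (without boundary) which is closed as a subset of $\Omega$; for instance $\Omega=\mathbb R^n$ and $M$ a closed submanifold of $\mathbb R^n$. Its supercurrent is $$[M]_s=c_p\,\nu\wedge \nu^\#\,{*dS_M},\qquad [M]_s.\varphi=\int_M\langle c_p\,\nu\wedge \nu^\#\wedge\varphi\rangle\,dS_M,$$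 where $\nu=n_1\wedge\dots\wedge n_p$ for any orthonormal basis $n_1,\dots,n_p$ of the conormal space of $M$ at the point, $c_p=(-1)^{p(p-1)/2}$, $dS_M$ is the $m$-dimensional surface measure of $M$, and $\langle a\rangle$ is the coefficient of $dx_1\wedge d\xi_1\wedge\dots\wedge dx_n\wedge d\xi_n$ in $a$. Locally let $\rho_1,\dots,\rho_p$ be smooth defining functions of $M$ whose differentials $n_j=d\rho_j$ are orthonormal on $M$, and let $H_j$ be the trace over $TM$ of the $(1,1)$-form $F_j=dn_j^\#=\sum_{k,l}\frac{\partial^2\rho_j}{\partial x_k\partial x_l}dx_k\wedge d\xi_l$. The *mean curvature vector* of $M$ is $\vec H=\sum_jH_j\vec n_j$, and $M$ is *minimal* if $\vec H=0$ at every point of $M$. **Corollary 5.2.** The supercurrent $[M]_s\wedge\beta^{m-1}$ on $\Omega$ is closed, i.e. $d([M]_s\wedge\beta^{m-1})=0$, if and only if $M$ is minimal. -/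

import Mathlib

open scoped ContDiff Distributions Gradient MeasureTheory

noncomputable section

namespace Super

/-! ### The superalgebra -/

/-- Euclidean space `ℝⁿ`. -/
abbrev E (n : ℕ) : Type := EuclideanSpace ℝ (Fin n)

/-- Constant covectors on the superspace `ℝⁿ ⊕ ℝⁿ`, in coordinates. The index `(i, 0)` stands for
`dx_i` and `(i, 1)` for `dξ_i`; the lexicographic order is `x₁, ξ₁, x₂, ξ₂, …`. -/
abbrev Covector (n : ℕ) : Type := (Fin n ×ₗ Fin 2) → ℝ

/-- Constant-coefficient superforms: the exterior algebra on `dx₁, dξ₁, …, dx_n, dξ_n`.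
The wedge product is the product of this algebra. -/
abbrev Form (n : ℕ) : Type := ExteriorAlgebra ℝ (Covector n)

/-- The basis of monomials in `dx₁, dξ₁, dx₂, dξ₂, …` (written in this order), indexed by finite
sets of indices. -/
def monomials (n : ℕ) : Module.Basis (Finset (Fin n ×ₗ Fin 2)) ℝ (Form n) :=
  (Pi.basisFun ℝ (Fin n ×ₗ Fin 2)).ExteriorAlgebra

/-- The (finite-dimensional) space of forms is normed by the largest absolute value of a
coefficient; only the resulting topology matters. -/
instance formNormedAddCommGroup (n : ℕ) : NormedAddCommGroup (Form n) :=
  NormedAddCommGroup.induced (Form n) (Finset (Fin n ×ₗ Fin 2) → ℝ)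
    (monomials n).equivFun.toLinearMap (monomials n).equivFun.injective

instance formNormedSpace (n : ℕ) : NormedSpace ℝ (Form n) :=
  NormedSpace.induced ℝ (Form n) (Finset (Fin n ×ₗ Fin 2) → ℝ)
    (monomials n).equivFun.toLinearMap

instance formFiniteDimensional (n : ℕ) : FiniteDimensional ℝ (Form n) :=
  (monomials n).finiteDimensional_of_finite

/-- `dx_i`. -/
def dx {n : ℕ} (i : Fin n) : Form n := ExteriorAlgebra.ι ℝ (Pi.single (toLex (i, 0)) 1)

/-- `dξ_i`. -/
def dxi {n : ℕ} (i : Fin n) : Form n := ExteriorAlgebra.ι ℝ (Pi.single (toLex (i, 1)) 1)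

/-- The complex structure on covectors: `J (dx_i) = dξ_i`, `J (dξ_i) = -dx_i`. -/
def covectorJ (n : ℕ) : Covector n →ₗ[ℝ] Covector n where
  toFun a k := if (ofLex k).2 = 0 then -a (toLex ((ofLex k).1, 1)) else a (toLex ((ofLex k).1, 0))
  map_add' a b := by
    funext k
    by_cases h : (ofLex k).2 = 0
    · simp [h]; ring
    · simp [h]
  map_smul' c a := by
    funext k
    by_cases h : (ofLex k).2 = 0 <;> simp [h]

/-- `J` extended multiplicatively to all forms; `J a` is also written `a^#` for `a` of bidegree
`(p, 0)`. -/
def J (n : ℕ) : Form n →ₐ[ℝ] Form n := ExteriorAlgebra.map (covectorJ n)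

/-- The sign automorphism: multiplication by `(-1)^k` on forms of total degree `k`. -/
def degreeSign (n : ℕ) : Form n →ₐ[ℝ] Form n :=
  ExteriorAlgebra.map (-(LinearMap.id : Covector n →ₗ[ℝ] Covector n))

/-- The coefficient `a₀` of `a = a₀ dx₁ ∧ dξ₁ ∧ … ∧ dx_n ∧ dξ_n + (other monomials)`: the
normalised Berezin integral, so that the superintegral of a superform `a` over `ℝⁿ` is
`∫ topCoeff (a x) dx`. -/
def topCoeff (n : ℕ) : Form n →ₗ[ℝ] ℝ := (monomials n).coord Finset.univ

/-- The Euclidean Kähler form `β = ∑ dx_i ∧ dξ_i`. -/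
def beta (n : ℕ) : Form n := ∑ i : Fin n, dx i * dxi i

/-- Wedge product with a fixed form on the left, as a continuous linear map. -/
def wedgeLeft {n : ℕ} (a : Form n) : Form n →L[ℝ] Form n :=
  LinearMap.toContinuousLinearMap (LinearMap.mulLeft ℝ a)

/-- The continuous bilinear pairing `(a, b) ↦ topCoeff (b ∧ a)`. -/
def pairing (n : ℕ) : Form n →L[ℝ] Form n →L[ℝ] ℝ :=
  LinearMap.toContinuousLinearMap
    ((LinearMap.toContinuousLinearMap (E := Form n) (F' := ℝ)).toLinearMap ∘ₗ
      (LinearMap.mul ℝ (Form n)).flip.compr₂ (topCoeff n))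

/-! ### Supercurrents -/

open TopologicalSpace (Opens)

/-- Supercurrents on an open set `Ω ⊆ ℝⁿ`: continuous linear functionals on the space of smooth
superforms with compact support in `Ω` (with its usual LF topology). Test forms of all bidegrees are
taken together, so this is the direct sum over `(p, q)` of the spaces of supercurrents of bidegree
`(p, q)`; the latter are the functionals that vanish on test forms of every bidegree other than
`(n - p, n - q)`. -/
abbrev Supercurrent {n : ℕ} (Ω : Opens (E n)) : Type := 𝓓(Ω, Form n) →L[ℝ] ℝ

/-- The exterior derivative of test superforms, `dφ = ∑ₖ dx_k ∧ ∂φ/∂x_k`. -/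
def dTest {n : ℕ} (Ω : Opens (E n)) : 𝓓(Ω, Form n) →L[ℝ] 𝓓(Ω, Form n) :=
  ∑ k : Fin n, (TestFunction.postcompCLM (wedgeLeft (dx k))).comp
    (TestFunction.lineDerivCLM ℝ (EuclideanSpace.single k (1 : ℝ)))

namespace Supercurrent

/-- The exterior derivative of a supercurrent: `dT.φ = (-1)^(k+1) T.dφ` for `T` of total degree `k`.
Only test forms `φ` of total degree `2n - k - 1` matter here, so the sign is `(-1)^(deg φ)`. -/
def d {n : ℕ} {Ω : Opens (E n)} (T : Supercurrent Ω) : Supercurrent Ω :=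
  T.comp ((dTest Ω).comp
    (TestFunction.postcompCLM (LinearMap.toContinuousLinearMap (degreeSign n).toLinearMap)))

/-- A supercurrent is closed if `dT = 0`. -/
def IsClosed {n : ℕ} {Ω : Opens (E n)} (T : Supercurrent Ω) : Prop := T.d = 0

/-- The wedge product `T ∧ α` with a constant-coefficient form: `(T ∧ α).φ = T.(α ∧ φ)`. -/
def wedge {n : ℕ} {Ω : Opens (E n)} (T : Supercurrent Ω) (a : Form n) : Supercurrent Ω :=
  T.comp (TestFunction.postcompCLM (wedgeLeft a))

end Supercurrent

/-! ### Submanifolds -/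

/-- `M` is a smooth (embedded) `m`-dimensional submanifold of the open set `Ω ⊆ ℝⁿ`, closed in `Ω`:
locally it is the zero set of `n - m` smooth functions whose differentials are linearly independent
on `M`. -/
structure IsSubmanifold {n : ℕ} (m : ℕ) (Ω : Opens (E n)) (M : Set (E n)) : Prop where
  subset : M ⊆ Ω
  closed : closure M ∩ Ω ⊆ M
  exists_defining : ∀ a ∈ M, ∃ (U : Set (E n)) (ρ : Fin (n - m) → E n → ℝ),
    IsOpen U ∧ a ∈ U ∧ (∀ j, ContDiffOn ℝ ∞ (ρ j) U) ∧
    M ∩ U = {x ∈ U | ∀ j, ρ j x = 0} ∧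
    ∀ x ∈ M ∩ U, LinearIndependent ℝ (fun j => fderiv ℝ (ρ j) x)

/-- The tangent space `T_x M`. -/
def tangentSpace {n : ℕ} (M : Set (E n)) (x : E n) : Submodule ℝ (E n) :=
  Submodule.span ℝ (tangentConeAt ℝ M x)

/-- The normal space `N_x M`. -/
def normalSpace {n : ℕ} (M : Set (E n)) (x : E n) : Submodule ℝ (E n) := (tangentSpace M x)ᗮ

/-- The `(1,0)`-form `∑ v_i dx_i` of a vector `v`. -/
def lower {n : ℕ} (v : E n) : Form n := ∑ i, v i • dx i

/-- The form `c_p ν ∧ ν^#` with `ν = n₁ ∧ … ∧ n_p` for an orthonormal basis `n₁, …, n_p` of the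
subspace `N` and `c_p = (-1)^(p(p-1)/2)`. It does not depend on the orthonormal basis. -/
def normalForm {n : ℕ} (N : Submodule ℝ (E n)) : Form n :=
  let p := Module.finrank ℝ N
  let ν : Form n := (List.ofFn fun j => lower (stdOrthonormalBasis ℝ N j : E n)).prod
  ((-1 : ℝ) ^ (p * (p - 1) / 2)) • (ν * J n ν)

/-- The supercurrent `[M]_s = c_p n ∧ n^# *dS_M` of an `m`-dimensional submanifold:
`[M]_s.φ = ∫_M topCoeff (c_p n ∧ n^# ∧ φ) dS_M`, where `dS_M` is the surface measure, i.e. the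
`m`-dimensional Hausdorff measure (normalised as Lebesgue measure on `m`-planes) restricted
to `M`. -/
def superCurrent {n : ℕ} (m : ℕ) (Ω : Opens (E n)) (M : Set (E n)) : Supercurrent Ω :=
  TestFunction.integralAgainstBilinCLM (pairing n) (μHE[m].restrict M)
    (fun x => normalForm (normalSpace M x))

/-! ### Mean curvature -/

/-- `ρ₁, …, ρ_{n-m}` are smooth defining functions of `M` in the open set `U` whose gradients
`n_j = ∇ρ_j` are orthonormal on `M`. -/
structure IsOrthonormalDefiningSystem {n : ℕ} (m : ℕ) (M U : Set (E n))
    (ρ : Fin (n - m) → E n → ℝ) : Prop where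
  isOpen : IsOpen U
  contDiffOn : ∀ j, ContDiffOn ℝ ∞ (ρ j) U
  inter_eq : M ∩ U = {x ∈ U | ∀ j, ρ j x = 0}
  orthonormal : ∀ x ∈ M ∩ U, Orthonormal ℝ (fun j => ∇ (ρ j) x)

/-- The trace `tr'` of the restriction of a bilinear form (i.e. a `(1,1)`-form at `x`) to `T_x M`. -/
def tangentialTrace {n : ℕ} (M : Set (E n)) (x : E n) (B : E n →L[ℝ] E n →L[ℝ] ℝ) : ℝ :=
  ∑ i, B (stdOrthonormalBasis ℝ (tangentSpace M x) i : E n)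
    (stdOrthonormalBasis ℝ (tangentSpace M x) i : E n)

/-- `H` is the mean curvature vector of `M` at `x`: `H = ∑ H_j n_j`, where `n_j = ∇ρ_j` for
defining functions `ρ_j` near `x` with gradients orthonormal on `M`, and `H_j` is the trace over
`T_x M` of `F_j = d n_j^# = ∑ (∂²ρ_j/∂x_k∂x_l) dx_k ∧ dξ_l`, i.e. of the Hessian of `ρ_j`. -/
def IsMeanCurvatureVector {n : ℕ} (m : ℕ) (M : Set (E n)) (x H : E n) : Prop :=
  ∃ (U : Set (E n)) (ρ : Fin (n - m) → E n → ℝ), x ∈ U ∧ IsOrthonormalDefiningSystem m M U ρ ∧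
    H = ∑ j, tangentialTrace M x (fderiv ℝ (fderiv ℝ (ρ j)) x) • ∇ (ρ j) x

/-- `M` is minimal: its mean curvature vector vanishes at every point. -/
def IsMinimal {n : ℕ} (m : ℕ) (M : Set (E n)) : Prop :=
  ∀ x ∈ M, IsMeanCurvatureVector m M x 0

end Super

end

/-! ### Exterior algebra: the elements `v ∧ v^#` and the form `β`. -/

namespace Super
open ExteriorAlgebra

variable {n : ℕ}

/-! Both conditions are compared with the first variation of area. In an orthonormal frame adapted
to `M`, the form `c_p ν ∧ ν^#` is the product of the elements `n_j ∧ n_j^#`, which are central and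
square to zero, while `β` is the sum of `v ∧ v^#` over any orthonormal basis of `ℝⁿ`. Hence only the
tangential part of `β` survives next to `c_p ν ∧ ν^#`, and `topCoeff_normalForm_mul` computes the
top coefficient of `c_p ν ∧ ν^# ∧ β^(m-1) ∧ dφ`: it is `(m-1)!` times the tangential divergence of
the vector field `X` formed by the `dξ_i` coefficients of `φ`. This gives
`IsSubmanifold.d_wedge_apply`: up to the nonzero factor `-(m-1)!`, the exterior derivative of the
current at `φ` is `∫_M div_M X dS_M`. Every smooth `X` with compact support in `Ω` arises in this
way.

In a local parametrization `f` with metric `g`, the area formula and integration by parts turn this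
integral into `-∫ ⟨L, X ∘ f⟩`, where `L = ∑ ∂_j(√g g^{ji} ∂_i f)`
(`IsChart.integral_tangentialDiv`). The vector `L` is normal to `M` (`IsParam.inner_laplacian_pd`),
and its component along `∇ρ_j` is `-√g H_j` (`IsParam.fderiv_laplacian`); therefore `L = 0` exactly
where the mean curvature vector vanishes (`IsChart.laplacian_eq_zero_iff`).

If `M` is minimal, the functional vanishes on forms supported in a chart, hence everywhere by a
partition of unity (`eq_zero_of_locally_eq_zero`). Conversely, bump vector fields in the direction
of `L` force `L = 0`. -/

theorem ι_mul_ι_swap (a b : Covector n) :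
    ι ℝ a * ι ℝ b = -(ι ℝ b * ι ℝ a) :=
  eq_neg_of_add_eq_zero_left (ι_add_mul_swap a b)

/-- Moving a generator past two covectors costs two signs, which cancel. -/
theorem ι_mul_ι_mem_center (a b : Covector n) :
    (ι ℝ a * ι ℝ b : Form n) ∈ Subalgebra.center ℝ (Form n) := by
  rw [Subalgebra.mem_center_iff]
  intro c
  induction c using ExteriorAlgebra.induction with
  | algebraMap r => exact Algebra.commutes r _
  | ι x =>
    rw [← mul_assoc, ι_mul_ι_swap x a, neg_mul, mul_assoc, ι_mul_ι_swap x b, mul_neg, neg_neg,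
      mul_assoc]
  | mul x y hx hy => rw [mul_assoc, hy, ← mul_assoc, hx, mul_assoc]
  | add x y hx hy => rw [add_mul, mul_add, hx, hy]

theorem add_pow_succ_of_sq_eq_zero {R : Type*} [CommRing R] {z : R} (hz : z * z = 0) (S : R)
    (k : ℕ) : (z + S) ^ (k + 1) = S ^ (k + 1) + (k + 1) * (z * S ^ k) := by
  induction k with
  | zero => simp [add_comm]
  | succ k ih =>
    rw [pow_succ, ih]
    push_cast
    linear_combination ((k : R) + 1) * S ^ k * hz

theorem prod_mul_eq_zero_of_mem {R κ : Type*} [CommRing R] {z : κ → R}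
    (hz : ∀ i, z i * z i = 0) {s : Finset κ} {i : κ} (hi : i ∈ s) : (∏ j ∈ s, z j) * z i = 0 := by
  classical
  rw [← Finset.mul_prod_erase s z hi, mul_assoc, mul_comm _ (z i), ← mul_assoc, hz, zero_mul]

/-- In the multinomial expansion only the squarefree monomial survives. This turns a product over a
frame into a power of a sum, and such sums do not depend on the frame. -/
theorem sum_pow_card_of_sq_eq_zero {R κ : Type*} [CommRing R] {z : κ → R}
    (hz : ∀ i, z i * z i = 0) (s : Finset κ) :
    (∑ i ∈ s, z i) ^ s.card = (s.card.factorial : R) * ∏ i ∈ s, z i := by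
  classical
  induction s using Finset.induction_on with
  | empty => simp
  | insert a s ha ih =>
    rw [Finset.sum_insert ha, Finset.card_insert_of_notMem ha, add_pow_succ_of_sq_eq_zero (hz a),
      Finset.prod_insert ha, pow_succ, ih, mul_assoc, Finset.mul_sum,
      Finset.sum_eq_zero fun i hi => prod_mul_eq_zero_of_mem hz hi, Nat.factorial_succ]
    push_cast
    ring

/-- The covector `∑ v_i dx_i` of a vector `v`. -/
noncomputable def covector : E n →ₗ[ℝ] Covector n where
  toFun v k := if (ofLex k).2 = 0 then v (ofLex k).1 else 0
  map_add' v w := by funext k; by_cases h : (ofLex k).2 = 0 <;> simp [h]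
  map_smul' c v := by funext k; by_cases h : (ofLex k).2 = 0 <;> simp [h]

theorem covector_single (i : Fin n) :
    covector (EuclideanSpace.single i (1 : ℝ)) = Pi.single (toLex (i, 0)) 1 := by
  funext k
  obtain ⟨⟨k, l⟩, rfl⟩ := toLex.surjective k
  by_cases hl : l = 0 <;> by_cases hk : k = i <;>
    simp_all [covector, Prod.ext_iff]

theorem covectorJ_covector_single (i : Fin n) :
    covectorJ n (covector (EuclideanSpace.single i (1 : ℝ))) = Pi.single (toLex (i, 1)) 1 := by
  funext k
  obtain ⟨⟨k, l⟩, rfl⟩ := toLex.surjective k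
  fin_cases l <;> by_cases hk : k = i <;>
    simp_all [covector, covectorJ, Prod.ext_iff]

theorem lower_eq_ι (v : E n) : lower v = ι ℝ (covector v) := by
  conv_rhs => rw [← (EuclideanSpace.basisFun (Fin n) ℝ).sum_repr v]
  simp [lower, dx, covector_single]

theorem J_lower_eq_ι (v : E n) : J n (lower v) = ι ℝ (covectorJ n (covector v)) := by
  rw [lower_eq_ι, J, map_apply_ι]

theorem dx_eq_lower (i : Fin n) : dx i = lower (EuclideanSpace.single i (1 : ℝ)) := by
  rw [lower_eq_ι, covector_single, dx]

theorem dxi_eq_J_lower (i : Fin n) : dxi i = J n (lower (EuclideanSpace.single i (1 : ℝ))) := by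
  rw [J_lower_eq_ι, covectorJ_covector_single, dxi]

/-- `(u, v) ↦ u ∧ v^#` as a bilinear map on vectors. -/
noncomputable def kahler : E n →ₗ[ℝ] E n →ₗ[ℝ] Form n :=
  (LinearMap.mul ℝ (Form n)).compl₁₂ (ι ℝ ∘ₗ covector) (ι ℝ ∘ₗ covectorJ n ∘ₗ covector)

theorem kahler_apply (u v : E n) : kahler u v = lower u * J n (lower v) := by
  rw [J_lower_eq_ι, lower_eq_ι]; rfl

/-- Frame independence of the trace, for vector-valued bilinear maps so that it applies to `kahler`.
-/
theorem sum_orthonormalBasis_eq {F W κ κ' : Type*} [NormedAddCommGroup F] [InnerProductSpace ℝ F]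
    [AddCommGroup W] [Module ℝ W] [Fintype κ] [Fintype κ'] (b : OrthonormalBasis κ ℝ F)
    (c : OrthonormalBasis κ' ℝ F) (B : F →ₗ[ℝ] F →ₗ[ℝ] W) :
    ∑ i, B (b i) (b i) = ∑ k, B (c k) (c k) := by
  classical
  have h (i : κ) : B (b i) (b i) = ∑ k, ∑ l, (inner ℝ (c k) (b i) * inner ℝ (b i) (c l)) •
      B (c k) (c l) := by
    conv_lhs => rw [← c.sum_repr' (b i)]
    simp only [map_sum, LinearMap.sum_apply, map_smul, LinearMap.smul_apply, Finset.smul_sum,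
      smul_smul]
    rw [Finset.sum_comm]
    refine Finset.sum_congr rfl fun k _ => Finset.sum_congr rfl fun l _ => ?_
    rw [real_inner_comm (b i) (c l)]
    ring_nf
  simp_rw [h]
  rw [Finset.sum_comm]
  refine Finset.sum_congr rfl fun k _ => ?_
  rw [Finset.sum_comm]
  simp_rw [← Finset.sum_smul, b.sum_inner_mul_inner, c.inner_eq_ite, ite_smul, one_smul, zero_smul]
  simp

theorem beta_eq_sum_kahler {κ : Type*} [Fintype κ] (b : OrthonormalBasis κ ℝ (E n)) :
    beta n = ∑ i, kahler (b i) (b i) := by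
  rw [sum_orthonormalBasis_eq b (EuclideanSpace.basisFun (Fin n) ℝ), beta]
  simp [kahler_apply, dx_eq_lower, dxi_eq_J_lower]

theorem ι_mul_prod_map_ι (a : Covector n) (l : List (Covector n)) :
    ι ℝ a * (l.map (ι ℝ)).prod = (-1 : ℝ) ^ l.length • ((l.map (ι ℝ)).prod * ι ℝ a) := by
  induction l with
  | nil => simp
  | cons b l ih =>
    rw [List.map_cons, List.prod_cons, ← mul_assoc, ι_mul_ι_swap, neg_mul, mul_assoc, ih,
      List.length_cons, pow_succ]
    simp [mul_assoc]

/-- The sign `c_p` is the one needed to interleave `ν` with `ν^#`: passing from length `p` to `p +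
1` moves one `v^#` past `p` covectors. -/
theorem prod_lower_mul_J (l : List (E n)) :
    (-1 : ℝ) ^ (l.length * (l.length - 1) / 2) •
      ((l.map lower).prod * J n (l.map lower).prod) = (l.map fun v => kahler v v).prod := by
  induction l with
  | nil => simp
  | cons v l ih =>
    have hl : l.map lower = (l.map covector).map (ι ℝ) := by
      simp [List.map_map, Function.comp_def, lower_eq_ι]
    have hswap := ι_mul_prod_map_ι (covectorJ n (covector v)) (l.map covector)
    rw [← hl, ← J_lower_eq_ι, List.length_map] at hswap
    have hswap' : (l.map lower).prod * J n (lower v) =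
        (-1 : ℝ) ^ l.length • (J n (lower v) * (l.map lower).prod) := by
      rw [hswap, smul_smul, ← mul_pow]; simp
    have hexp : (l.length + 1) * (l.length + 1 - 1) / 2
        = l.length * (l.length - 1) / 2 + l.length := by
      rw [Nat.add_sub_cancel]
      cases l.length with
      | zero => rfl
      | succ k =>
        rw [Nat.add_sub_cancel, show (k + 1 + 1) * (k + 1) = (k + 1) * k + (k + 1) * 2 by ring,
          Nat.add_mul_div_right _ _ two_pos]
    rw [List.map_cons, List.prod_cons, map_mul, List.length_cons, hexp, List.map_cons,
      List.prod_cons, ← ih, kahler_apply,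
      show lower v * (l.map lower).prod * (J n (lower v) * J n (l.map lower).prod) =
        lower v * ((l.map lower).prod * J n (lower v)) * J n (l.map lower).prod by
        simp only [mul_assoc], hswap']
    simp only [mul_smul_comm, smul_mul_assoc, smul_smul, mul_assoc]
    rw [pow_add, mul_assoc, ← mul_pow]; simp

end Super
-- Wedge products with powers of `β` in an orthonormal frame.
namespace Super
open ExteriorAlgebra

variable {n : ℕ}

theorem lower_mul_self (u : E n) : lower u * lower u = 0 := by
  rw [lower_eq_ι, ι_sq_zero]

theorem J_lower_mul_self (u : E n) : J n (lower u) * J n (lower u) = 0 := by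
  rw [J_lower_eq_ι, ι_sq_zero]

/-- The central element `v ∧ v^#`. -/
noncomputable def kahlerSq (v : E n) : Subalgebra.center ℝ (Form n) :=
  ⟨kahler v v, by rw [kahler_apply, J_lower_eq_ι, lower_eq_ι]; exact ι_mul_ι_mem_center _ _⟩

theorem coe_kahlerSq (v : E n) : (kahlerSq v : Form n) = lower v * J n (lower v) :=
  kahler_apply v v

theorem center_mul_comm (c : Subalgebra.center ℝ (Form n)) (a : Form n) : a * c = c * a :=
  Subalgebra.mem_center_iff.1 c.2 a

theorem lower_mul_kahlerSq (v : E n) : lower v * kahlerSq v = 0 := by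
  rw [coe_kahlerSq, ← mul_assoc, lower_mul_self, zero_mul]

theorem kahlerSq_mul_J_lower (v : E n) : (kahlerSq v : Form n) * J n (lower v) = 0 := by
  rw [coe_kahlerSq, mul_assoc, J_lower_mul_self, mul_zero]

theorem kahlerSq_mul_self (v : E n) : kahlerSq v * kahlerSq v = 0 := by
  apply Subtype.ext
  change (kahlerSq v : Form n) * kahlerSq v = 0
  conv_lhs => enter [2]; rw [coe_kahlerSq]
  rw [← mul_assoc, ← center_mul_comm, lower_mul_kahlerSq, zero_mul]

theorem beta_eq_sum {κ : Type*} [Fintype κ] (b : OrthonormalBasis κ ℝ (E n)) :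
    beta n = ((∑ i, kahlerSq (b i) : Subalgebra.center ℝ (Form n)) : Form n) := by
  rw [beta_eq_sum_kahler b]
  simp [kahlerSq]

/-- The form `dx₁ ∧ dξ₁ ∧ … ∧ dx_n ∧ dξ_n`. -/
noncomputable def topForm (n : ℕ) : Subalgebra.center ℝ (Form n) :=
  ∏ i : Fin n, kahlerSq (EuclideanSpace.single i 1)

/-- Both sides equal `β^n / n!`, and `β` does not see the choice of basis. -/
theorem prod_kahlerSq {κ : Type*} [Fintype κ] (b : OrthonormalBasis κ ℝ (E n)) :
    ∏ i, kahlerSq (b i) = topForm n := by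
  have hcard : Fintype.card κ = n := by
    simpa using (Module.finrank_eq_card_basis b.toBasis).symm
  have h1 := sum_pow_card_of_sq_eq_zero (fun i => kahlerSq_mul_self (b i)) Finset.univ
  have h2 := sum_pow_card_of_sq_eq_zero
    (fun i => kahlerSq_mul_self (EuclideanSpace.basisFun (Fin n) ℝ i)) Finset.univ
  have h3 : ∑ i, kahlerSq (b i) = ∑ i, kahlerSq (EuclideanSpace.basisFun (Fin n) ℝ i) :=
    Subtype.ext ((beta_eq_sum b).symm.trans (beta_eq_sum _))
  rw [Finset.card_univ, hcard, h3] at h1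
  rw [Finset.card_univ, Fintype.card_fin, h1, ← nsmul_eq_mul, ← nsmul_eq_mul,
    ← Nat.cast_smul_eq_nsmul ℝ, ← Nat.cast_smul_eq_nsmul ℝ] at h2
  have := smul_right_injective _ (Nat.cast_ne_zero.2 n.factorial_ne_zero : (n.factorial : ℝ) ≠ 0) h2
  rw [this, topForm]
  simp

theorem lower_eq_sum {κ : Type*} [Fintype κ] (b : OrthonormalBasis κ ℝ (E n)) (u : E n) :
    lower u = ∑ i, inner ℝ (b i) u • lower (b i) := by
  conv_lhs => rw [← b.sum_repr' u]
  simp [lower_eq_ι]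

theorem lower_mul_prod_kahlerSq {κ : Type*} (b : κ → E n) {s : Finset κ} {i : κ} (hi : i ∈ s) :
    lower (b i) * (∏ j ∈ s, kahlerSq (b j) : Subalgebra.center ℝ (Form n)) = 0 := by
  classical
  rw [← Finset.mul_prod_erase s _ hi, MulMemClass.coe_mul, ← mul_assoc, lower_mul_kahlerSq,
    zero_mul]

theorem prod_kahlerSq_mul_J_lower {κ : Type*} (b : κ → E n) {s : Finset κ} {i : κ} (hi : i ∈ s) :
    ((∏ j ∈ s, kahlerSq (b j) : Subalgebra.center ℝ (Form n)) : Form n) * J n (lower (b i)) = 0 := by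
  classical
  rw [← Finset.prod_erase_mul s _ hi, MulMemClass.coe_mul, mul_assoc, kahlerSq_mul_J_lower,
    mul_zero]

/-- The vector formed by the `dx` components of a covector. -/
noncomputable def xPart : Covector n →ₗ[ℝ] E n where
  toFun v := WithLp.toLp 2 fun i => v (toLex (i, 0))
  map_add' _ _ := rfl
  map_smul' _ _ := rfl

/-- The vector formed by the `dξ` components of a covector. -/
noncomputable def xiPart : Covector n →ₗ[ℝ] E n where
  toFun v := WithLp.toLp 2 fun i => v (toLex (i, 1))
  map_add' _ _ := rfl
  map_smul' _ _ := rfl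

theorem xPart_apply (v : Covector n) (i : Fin n) : xPart v i = v (toLex (i, 0)) := rfl

theorem xiPart_apply (v : Covector n) (i : Fin n) : xiPart v i = v (toLex (i, 1)) := rfl

theorem ι_eq_lower_add_J_lower (v : Covector n) :
    ι ℝ v = lower (xPart v) + J n (lower (xiPart v)) := by
  rw [J_lower_eq_ι, lower_eq_ι, ← map_add]
  congr 1
  funext k
  obtain ⟨⟨k, l⟩, rfl⟩ := toLex.surjective k
  fin_cases l <;> simp [covector, covectorJ, xPart_apply, xiPart_apply]

/-- Every covector annihilates the top form, so only the scalar part of `a` survives. -/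
theorem topForm_mul (a : Form n) :
    (topForm n : Form n) * a = algebraMapInv a • (topForm n : Form n) := by
  induction a using ExteriorAlgebra.induction with
  | algebraMap r => simp [← Algebra.commutes, Algebra.smul_def]
  | ι v =>
    rw [algebraMapInv, lift_ι_apply, LinearMap.zero_apply, zero_smul, ι_eq_lower_add_J_lower,
      mul_add, ← center_mul_comm, lower_eq_sum (EuclideanSpace.basisFun (Fin n) ℝ),
      lower_eq_sum (EuclideanSpace.basisFun (Fin n) ℝ) (xiPart v), topForm, map_sum,
      Finset.sum_mul, Finset.mul_sum]
    simp only [← EuclideanSpace.basisFun_apply]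
    rw [Finset.sum_eq_zero, Finset.sum_eq_zero, zero_add]
    · intro i _
      rw [map_smul, mul_smul_comm, prod_kahlerSq_mul_J_lower _ (Finset.mem_univ i), smul_zero]
    · intro i _
      rw [smul_mul_assoc, lower_mul_prod_kahlerSq _ (Finset.mem_univ i), smul_zero]
  | mul x y hx hy => rw [← mul_assoc, hx, smul_mul_assoc, hy, smul_smul, map_mul]
  | add x y hx hy => rw [mul_add, hx, hy, map_add, add_smul]

theorem mul_add_pow_of_mul_eq_zero {R : Type*} [Ring R] {x p q : R} (hx : x * p = 0)
    (hpq : Commute p q) (k : ℕ) : x * (p + q) ^ k = x * q ^ k := by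
  induction k with
  | zero => simp
  | succ k ih =>
    rw [pow_succ, ← mul_assoc, ih, mul_add, mul_assoc x, ← (hpq.pow_right k).eq, ← mul_assoc, hx,
      zero_mul, zero_add, mul_assoc, ← pow_succ]

section Basis

variable {κ : Type*} [Fintype κ] (b : OrthonormalBasis κ ℝ (E n)) (s : Finset κ)

theorem prod_mul_beta_pow_mul_lower_of_mem {i : κ} (hi : i ∈ s) (k : ℕ) :
    ((∏ j ∈ s, kahlerSq (b j) : Subalgebra.center ℝ (Form n)) : Form n) * beta n ^ k *
      lower (b i) = 0 := by
  rw [beta_eq_sum b, ← SubmonoidClass.coe_pow, ← MulMemClass.coe_mul, ← center_mul_comm,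
    MulMemClass.coe_mul, ← mul_assoc, lower_mul_prod_kahlerSq _ hi, zero_mul]

variable [DecidableEq κ]

/-- Next to `b_i` and the product over `s`, the summands of `β` with index in `s` or equal to `i`
die. The exponent equals the number of remaining summands, so their power is a factorial times their
product. -/
theorem prod_mul_beta_pow_mul_lower_of_notMem {i : κ} (hi : i ∉ s) :
    ((∏ j ∈ s, kahlerSq (b j) : Subalgebra.center ℝ (Form n)) : Form n) *
      beta n ^ (sᶜ.card - 1) * lower (b i) =
      ((sᶜ.card - 1).factorial : ℝ) • (lower (b i) *
        (∏ j ∈ Finset.univ.erase i, kahlerSq (b j) : Subalgebra.center ℝ (Form n))) := by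
  set z : κ → Subalgebra.center ℝ (Form n) := fun j => kahlerSq (b j)
  have hz : ∀ j, z j * z j = 0 := fun j => kahlerSq_mul_self _
  set t := (insert i s)ᶜ with ht
  have htcard : t.card = sᶜ.card - 1 := by
    rw [ht, Finset.card_compl, Finset.card_compl, Finset.card_insert_of_notMem hi, Nat.sub_add_eq]
  have hbeta : beta n = (((z i + ∑ j ∈ s, z j) + ∑ j ∈ t, z j : Subalgebra.center ℝ (Form n)) :
      Form n) := by
    rw [beta_eq_sum b, ← Finset.sum_insert hi, ht, Finset.sum_add_sum_compl]
  have hx : lower (b i) * ((∏ j ∈ s, z j : Subalgebra.center ℝ (Form n)) : Form n) *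
      ((z i + ∑ j ∈ s, z j : Subalgebra.center ℝ (Form n)) : Form n) = 0 := by
    rw [mul_assoc, ← MulMemClass.coe_mul, mul_add, Finset.mul_sum,
      Finset.sum_eq_zero fun j hj => prod_mul_eq_zero_of_mem hz hj, add_zero, mul_comm,
      MulMemClass.coe_mul, ← mul_assoc, lower_mul_kahlerSq, zero_mul]
  have hprod : (∏ j ∈ s, z j) * ∏ j ∈ t, z j = ∏ j ∈ Finset.univ.erase i, z j := by
    rw [← Finset.prod_union]
    · congr 1
      ext j
      by_cases h : j = i <;> by_cases h' : j ∈ s <;> simp_all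
    · rw [Finset.disjoint_left]
      intro j hj
      simp [ht, hj]
  have hpow := sum_pow_card_of_sq_eq_zero hz t
  rw [htcard] at hpow
  rw [hbeta, ← SubmonoidClass.coe_pow, ← MulMemClass.coe_mul, ← center_mul_comm,
    MulMemClass.coe_mul, ← mul_assoc, SubmonoidClass.coe_pow, AddMemClass.coe_add,
    mul_add_pow_of_mul_eq_zero hx (center_mul_comm _ _), ← SubmonoidClass.coe_pow, hpow, mul_assoc,
    ← MulMemClass.coe_mul, ← hprod, mul_left_comm, ← nsmul_eq_mul, ← Nat.cast_smul_eq_nsmul ℝ]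
  simp

/-- After wedging with `u`, every direction of the frame already occurs as a `dx` factor, so another
one gives zero. -/
theorem prod_mul_beta_pow_mul_lower_mul_lower (u w : E n) :
    ((∏ j ∈ s, kahlerSq (b j) : Subalgebra.center ℝ (Form n)) : Form n) *
      beta n ^ (sᶜ.card - 1) * lower u * lower w = 0 := by
  rw [lower_eq_sum b u, Finset.mul_sum, Finset.sum_mul]
  refine Finset.sum_eq_zero fun i _ => ?_
  rw [lower_eq_sum b w, Finset.mul_sum]
  refine Finset.sum_eq_zero fun j _ => ?_
  rw [mul_smul_comm, mul_smul_comm, smul_mul_assoc]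
  by_cases hi : i ∈ s
  · rw [prod_mul_beta_pow_mul_lower_of_mem b s hi]; simp
  rw [prod_mul_beta_pow_mul_lower_of_notMem b s hi, smul_mul_assoc, mul_assoc, ← center_mul_comm]
  rcases eq_or_ne j i with rfl | hij
  · rw [← mul_assoc, lower_mul_self]; simp
  · rw [lower_mul_prod_kahlerSq _ (Finset.mem_erase.2 ⟨hij, Finset.mem_univ j⟩)]; simp

/-- In the double expansion along the frame, a term `b_i`, `b_j^#` survives only for `i = j ∉ s`,
where it completes the top form. -/
theorem prod_mul_beta_pow_mul_lower_mul_J_lower (u w : E n) :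
    ((∏ j ∈ s, kahlerSq (b j) : Subalgebra.center ℝ (Form n)) : Form n) *
      beta n ^ (sᶜ.card - 1) * lower u * J n (lower w) =
    (((sᶜ.card - 1).factorial : ℝ) * ∑ i ∈ sᶜ, inner ℝ (b i) u * inner ℝ (b i) w) •
      (topForm n : Form n) := by
  rw [lower_eq_sum b u, Finset.mul_sum, Finset.sum_mul, Finset.mul_sum,
    Finset.sum_smul, ← Finset.sum_subset (Finset.subset_univ sᶜ)]
  · refine Finset.sum_congr rfl fun i hi => ?_
    rw [Finset.mem_compl] at hi
    rw [mul_smul_comm, prod_mul_beta_pow_mul_lower_of_notMem b s hi, lower_eq_sum b w, map_sum, Finset.mul_sum,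
      Finset.sum_eq_single_of_mem i (Finset.mem_univ i)]
    · rw [map_smul, mul_smul_comm, smul_mul_assoc, smul_mul_assoc, mul_assoc, ← center_mul_comm,
        ← mul_assoc, ← coe_kahlerSq, ← MulMemClass.coe_mul,
        Finset.mul_prod_erase _ (fun j => kahlerSq (b j)) (Finset.mem_univ i), prod_kahlerSq b]
      simp only [smul_smul]
      ring_nf
    · intro j _ hj
      rw [map_smul, mul_smul_comm, smul_mul_assoc, smul_mul_assoc, mul_assoc,
        prod_kahlerSq_mul_J_lower _ (Finset.mem_erase.2 ⟨hj, Finset.mem_univ j⟩)]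
      simp
  · intro i _ hi
    rw [Finset.mem_compl, not_not] at hi
    rw [mul_smul_comm, prod_mul_beta_pow_mul_lower_of_mem b s hi]
    simp

end Basis

/-- The functional on forms that extracts the `dξ_i` component. -/
noncomputable def xiCoeff (i : Fin n) : Form n →ₗ[ℝ] ℝ :=
  algebraMapInv.toLinearMap ∘ₗ CliffordAlgebra.contractLeft (LinearMap.proj (toLex (i, 1)))

/-- The vector formed by the `dξ` components of a form. -/
noncomputable def xiVector : Form n →ₗ[ℝ] E n :=
  (WithLp.linearEquiv 2 ℝ (Fin n → ℝ)).symm.toLinearMap ∘ₗ LinearMap.pi xiCoeff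

theorem xiVector_algebraMap (r : ℝ) : xiVector (algebraMap ℝ (Form n) r) = 0 := by
  ext i
  simp [xiVector, xiCoeff, ExteriorAlgebra]

/-- Contraction is an antiderivation; its second term keeps the factor `v` and so has no scalar
part. -/
theorem xiVector_ι_mul (v : Covector n) (a : Form n) :
    xiVector (ι ℝ v * a) = algebraMapInv a • xiPart v := by
  ext i
  have : xiCoeff i (ι ℝ v * a) = v (toLex (i, 1)) * algebraMapInv a := by
    change algebraMapInv (CliffordAlgebra.contractLeft _ (CliffordAlgebra.ι _ v * a)) = _
    rw [CliffordAlgebra.contractLeft_ι_mul, map_sub, map_mul]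
    have h0 : algebraMapInv (CliffordAlgebra.ι (0 : QuadraticForm ℝ (Covector n)) v) = 0 := by
      change algebraMapInv (ι ℝ v) = 0
      rw [algebraMapInv, lift_ι_apply, LinearMap.zero_apply]
    rw [h0]
    simp
  simp [xiVector, xiPart_apply, this, mul_comm]

theorem xiVector_J_lower (w : E n) : xiVector (J n (lower w)) = w := by
  rw [J_lower_eq_ι, ← mul_one (ι ℝ _), xiVector_ι_mul, map_one, one_smul]
  ext i
  simp [xiPart_apply, covectorJ, covector]

end Super
-- The top coefficient and the parity of forms.
namespace Super
open ExteriorAlgebra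

variable {n : ℕ}

theorem monomials_apply (s : Finset (Fin n ×ₗ Fin 2)) :
    monomials n s = ιMulti ℝ s.card (Pi.basisFun ℝ _ ∘ s.orderEmbOfFin rfl) := by
  rw [monomials, basis_apply]
  rfl

theorem coe_topForm : (topForm n : Form n) = ((List.finRange n).map fun i => dx i * dxi i).prod := by
  have h : topForm n = ((List.finRange n).map fun i => kahlerSq (EuclideanSpace.single i 1)).prod := by
    rw [topForm, Fin.prod_univ_def]
  rw [h, ← Subalgebra.coe_val, map_list_prod, List.map_map]
  congr 1
  refine List.map_congr_left fun i _ => ?_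
  simp [coe_kahlerSq, dx_eq_lower, dxi_eq_J_lower]

theorem topCoeff_topForm : topCoeff n (topForm n) = 1 := by
  have h : (topForm n : Form n) = monomials n Finset.univ := by
    rw [coe_topForm, monomials_apply, ιMulti_apply]
    set e := (Finset.univ : Finset (Fin n ×ₗ Fin 2)).orderEmbOfFin rfl
    have hrange (a : Fin n ×ₗ Fin 2) : ∃ k, e k = a := by
      have : a ∈ Set.range e := by rw [Finset.range_orderEmbOfFin]; simp
      exact this
    -- Both lists are strictly increasing with the same entries, hence equal. Thus the monomial of
    -- the full index set is the top form with sign `+1`.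
    have hlist : List.ofFn e =
        (List.finRange n).flatMap fun i => [toLex (i, (0 : Fin 2)), toLex (i, 1)] := by
      refine List.Perm.eq_of_pairwise' (r := (· < ·)) ?_ ?_ ?_
      · rw [List.pairwise_ofFn]
        exact fun i j hij => e.strictMono hij
      · rw [List.pairwise_flatMap]
        refine ⟨fun i _ => ?_, ?_⟩
        · simp [Prod.Lex.toLex_lt_toLex]
        · refine (List.pairwise_lt_finRange n).imp fun {i j} hij => ?_
          simp [Prod.Lex.toLex_lt_toLex, hij]
      · rw [List.perm_ext_iff_of_nodup]
        · intro a
          have h1 := hrange a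
          obtain ⟨⟨i, l⟩, rfl⟩ := toLex.surjective a
          rw [List.mem_ofFn']
          fin_cases l <;> simpa using h1
        · rw [List.nodup_ofFn]
          exact e.injective
        · rw [List.nodup_flatMap]
          refine ⟨fun i _ => by simp, (List.nodup_finRange n).imp fun {i j} hij => ?_⟩
          simp [Function.onFun, Ne.symm hij]
    have : (List.ofFn fun i => ι ℝ ((Pi.basisFun ℝ (Fin n ×ₗ Fin 2) ∘ e) i)) =
        (List.ofFn e).map fun k => ι ℝ (Pi.basisFun ℝ _ k) := by
      rw [List.map_ofFn]; rfl
    rw [this, hlist, List.map_flatMap, List.flatMap, List.prod_flatten, List.map_map]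
    congr 1
    refine List.map_congr_left fun i _ => ?_
    simp [dx, dxi]
  rw [h, topCoeff, Module.Basis.coord_apply, Module.Basis.repr_self, Finsupp.single_eq_same]

/-- The full monomial has `2n` factors, an even number. Consequently odd forms have no top
coefficient. -/
theorem topCoeff_degreeSign (a : Form n) : topCoeff n (degreeSign n a) = topCoeff n a := by
  suffices topCoeff n ∘ₗ (degreeSign n).toLinearMap = topCoeff n from LinearMap.congr_fun this a
  refine (monomials n).ext fun s => ?_
  have h : degreeSign n (monomials n s) = (-1 : ℝ) ^ s.card • monomials n s := by
    rw [monomials_apply, degreeSign, map_apply_ιMulti]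
    have := (ιMulti ℝ s.card).map_smul_univ (fun _ => (-1 : ℝ))
      (Pi.basisFun ℝ (Fin n ×ₗ Fin 2) ∘ s.orderEmbOfFin rfl)
    simp only [Finset.prod_const, Finset.card_univ, Fintype.card_fin] at this
    rw [← this]
    congr 1
    funext i
    simp
  change topCoeff n (degreeSign n _) = _
  rw [h, map_smul, topCoeff, Module.Basis.coord_apply, Module.Basis.repr_self]
  by_cases hs : s = Finset.univ
  · subst hs
    have : (Finset.univ : Finset (Fin n ×ₗ Fin 2)).card = n * 2 := by
      rw [Finset.card_univ, Fintype.card_lex]; simp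
    rw [this, mul_comm n 2, pow_mul]
    simp
  · rw [Finsupp.single_eq_of_ne' hs, smul_zero]

theorem degreeSign_lower (v : E n) : degreeSign n (lower v) = -lower v := by
  rw [lower_eq_ι, degreeSign, map_apply_ι]; simp

theorem degreeSign_J_lower (v : E n) : degreeSign n (J n (lower v)) = -J n (lower v) := by
  rw [J_lower_eq_ι, degreeSign, map_apply_ι]; simp

theorem degreeSign_kahler (u v : E n) : degreeSign n (kahler u v) = kahler u v := by
  rw [kahler_apply, map_mul, degreeSign_lower, degreeSign_J_lower, neg_mul_neg]

theorem degreeSign_beta : degreeSign n (beta n) = beta n := by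
  rw [beta_eq_sum_kahler (EuclideanSpace.basisFun (Fin n) ℝ), map_sum]
  simp only [degreeSign_kahler]

theorem topCoeff_eq_zero_of_degreeSign {a : Form n} (h : degreeSign n a = -a) :
    topCoeff n a = 0 := by
  have := topCoeff_degreeSign a
  rw [h, map_neg] at this
  linarith

theorem degreeSign_prod_kahlerSq {κ : Type*} (b : κ → E n) (s : Finset κ) :
    degreeSign n (∏ j ∈ s, kahlerSq (b j) : Subalgebra.center ℝ (Form n)) =
      (∏ j ∈ s, kahlerSq (b j) : Subalgebra.center ℝ (Form n)) := by
  classical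
  induction s using Finset.induction_on with
  | empty => simp
  | insert a s ha ih =>
    rw [Finset.prod_insert ha, MulMemClass.coe_mul, map_mul, ih, kahlerSq, degreeSign_kahler]

/-- Only the component of degree one is seen by `xiVector`. -/
theorem xiVector_degreeSign (a : Form n) : xiVector (degreeSign n a) = - xiVector a := by
  have hinv (a : Form n) : algebraMapInv (degreeSign n a) = algebraMapInv a := by
    induction a using ExteriorAlgebra.induction with
    | algebraMap r => simp [AlgHom.commutes]
    | ι v => simp [degreeSign, algebraMapInv]
    | mul x y hx hy => simp only [map_mul, hx, hy]
    | add x y hx hy => simp only [map_add, hx, hy]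
  induction a using CliffordAlgebra.left_induction with
  | algebraMap r =>
    change xiVector (degreeSign n (algebraMap ℝ (Form n) r)) = -xiVector (algebraMap ℝ (Form n) r)
    rw [AlgHom.commutes, xiVector_algebraMap, neg_zero]
  | add x y hx hy =>
    change xiVector (degreeSign n ((x : Form n) + y)) = -xiVector ((x : Form n) + y)
    simp only [map_add]
    rw [neg_add]
    exact congrArg₂ _ hx hy
  | ι_mul x m hx =>
    change xiVector (degreeSign n (ι ℝ m * (x : Form n))) = -xiVector (ι ℝ m * (x : Form n))
    have : degreeSign n (ι ℝ m) = ι ℝ (-m) := by rw [degreeSign, map_apply_ι]; rfl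
    rw [map_mul, this, xiVector_ι_mul, xiVector_ι_mul, hinv, map_neg, smul_neg]

section Basis

variable {κ : Type*} [Fintype κ] [DecidableEq κ] (b : OrthonormalBasis κ ℝ (E n)) (s : Finset κ)

/-- The product in front of `a` is one degree short of the top, so only the degree-one part of `a`
contributes, and of that only the `dξ` part. -/
theorem topCoeff_prod_mul_beta_pow_mul_lower_mul (u : E n) (a : Form n) :
    topCoeff n (((∏ j ∈ s, kahlerSq (b j) : Subalgebra.center ℝ (Form n)) : Form n) *
      beta n ^ (sᶜ.card - 1) * lower u * a) =
    ((sᶜ.card - 1).factorial : ℝ) * ∑ i ∈ sᶜ, inner ℝ (b i) u * inner ℝ (b i) (xiVector a) := by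
  set c := ((∏ j ∈ s, kahlerSq (b j) : Subalgebra.center ℝ (Form n)) : Form n) *
      beta n ^ (sᶜ.card - 1) * lower u with hc
  have hsign : degreeSign n c = -c := by
    rw [hc, map_mul, map_mul, map_pow, degreeSign_lower, degreeSign_beta, degreeSign_prod_kahlerSq,
      mul_neg]
  have hι (v : Covector n) : c * ι ℝ v = (((sᶜ.card - 1).factorial : ℝ) *
      ∑ i ∈ sᶜ, inner ℝ (b i) u * inner ℝ (b i) (xiPart v)) • (topForm n : Form n) := by
    rw [ι_eq_lower_add_J_lower, mul_add, hc, prod_mul_beta_pow_mul_lower_mul_lower, zero_add,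
      prod_mul_beta_pow_mul_lower_mul_J_lower]
  -- The induction on `a` needs only two facts: `c` is odd, which settles scalars, and `c` times a
  -- covector is a multiple of the top form, which settles products by `topForm_mul`.
  clear_value c
  induction a using CliffordAlgebra.left_induction with
  | algebraMap r =>
    change topCoeff n (c * algebraMap ℝ (Form n) r) = _ * ∑ i ∈ sᶜ, inner ℝ (b i) u *
      inner ℝ (b i) (xiVector (algebraMap ℝ (Form n) r))
    rw [xiVector_algebraMap, ← Algebra.commutes, ← Algebra.smul_def, map_smul,
      topCoeff_eq_zero_of_degreeSign hsign]
    simp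
  | add x y hx hy =>
    change topCoeff n (c * ((x : Form n) + y)) = _ * ∑ i ∈ sᶜ, inner ℝ (b i) u *
      inner ℝ (b i) (xiVector ((x : Form n) + y))
    rw [mul_add, map_add, map_add]
    simp only [inner_add_right, mul_add, Finset.sum_add_distrib]
    exact congrArg₂ _ hx hy
  | ι_mul x m hx =>
    change topCoeff n (c * (ι ℝ m * (x : Form n))) = _ * ∑ i ∈ sᶜ, inner ℝ (b i) u *
      inner ℝ (b i) (xiVector (ι ℝ m * (x : Form n)))
    rw [xiVector_ι_mul, ← mul_assoc, hι, smul_mul_assoc, topForm_mul, map_smul, map_smul,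
      topCoeff_topForm]
    simp only [inner_smul_right, smul_eq_mul, mul_one, Finset.mul_sum, Finset.sum_mul]
    refine Finset.sum_congr rfl fun i _ => ?_
    ring

end Basis

end Super
-- The form `c_p ν ∧ ν^#` in a frame adapted to the tangent space.
namespace Super
open ExteriorAlgebra Module

variable {n : ℕ}

theorem normalForm_eq_prod (N : Submodule ℝ (E n)) :
    normalForm N = (∏ j, kahlerSq (stdOrthonormalBasis ℝ N j : E n) :
      Subalgebra.center ℝ (Form n)) := by
  have h := prod_lower_mul_J (List.ofFn fun j => (stdOrthonormalBasis ℝ N j : E n))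
  rw [List.length_ofFn, List.map_ofFn, List.map_ofFn] at h
  rw [normalForm]
  refine h.trans ?_
  rw [← List.prod_ofFn, ← Subalgebra.coe_val, map_list_prod, List.map_ofFn]
  rfl

theorem finrank_orthogonal (T : Submodule ℝ (E n)) : finrank ℝ Tᗮ = n - finrank ℝ T := by
  have := T.finrank_add_finrank_orthogonal
  rw [finrank_euclideanSpace_fin] at this
  omega

theorem orthonormal_normal_tangent (T : Submodule ℝ (E n)) :
    Orthonormal ℝ (Sum.elim (fun j => (stdOrthonormalBasis ℝ Tᗮ j : E n))
      (fun j => (stdOrthonormalBasis ℝ T j : E n))) := by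
  rw [orthonormal_iff_ite]
  have hN := orthonormal_iff_ite.1 (stdOrthonormalBasis ℝ Tᗮ).orthonormal
  have hT := orthonormal_iff_ite.1 (stdOrthonormalBasis ℝ T).orthonormal
  rintro (i | i) (j | j)
  · simpa using hN i j
  · simpa using T.inner_left_of_mem_orthogonal (stdOrthonormalBasis ℝ T j).2
      (stdOrthonormalBasis ℝ Tᗮ i).2
  · simpa using T.inner_right_of_mem_orthogonal (stdOrthonormalBasis ℝ T i).2
      (stdOrthonormalBasis ℝ Tᗮ j).2
  · simpa using hT i j

/-- The orthonormal basis of `ℝⁿ` adapted to the decomposition `Tᗮ ⊕ T`. -/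
noncomputable def adaptedBasis (T : Submodule ℝ (E n)) :
    OrthonormalBasis (Fin (finrank ℝ Tᗮ) ⊕ Fin (finrank ℝ T)) ℝ (E n) :=
  OrthonormalBasis.mk (orthonormal_normal_tangent T) <| by
    refine ((orthonormal_normal_tangent T).linearIndependent.span_eq_top_of_card_eq_finrank'
      ?_).ge
    rw [Fintype.card_sum, Fintype.card_fin, Fintype.card_fin, add_comm,
      T.finrank_add_finrank_orthogonal]

theorem adaptedBasis_inl (T : Submodule ℝ (E n)) (j : Fin (finrank ℝ Tᗮ)) :
    adaptedBasis T (Sum.inl j) = stdOrthonormalBasis ℝ Tᗮ j := by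
  simp [adaptedBasis]

theorem adaptedBasis_inr (T : Submodule ℝ (E n)) (j : Fin (finrank ℝ T)) :
    adaptedBasis T (Sum.inr j) = stdOrthonormalBasis ℝ T j := by
  simp [adaptedBasis]

/-- The normal part of `β` is `β` minus its tangential part, and its top power is a factorial times
the product over a normal frame. No normal frame appears on the right, which is what makes
continuity in the base point accessible. -/
theorem normalForm_orthogonal (T : Submodule ℝ (E n)) :
    normalForm Tᗮ = ((n - finrank ℝ T).factorial : ℝ)⁻¹ •
      (beta n - ∑ i, kahler (stdOrthonormalBasis ℝ T i : E n) (stdOrthonormalBasis ℝ T i : E n)) ^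
        (n - finrank ℝ T) := by
  have h := sum_pow_card_of_sq_eq_zero
    (fun j => kahlerSq_mul_self (stdOrthonormalBasis ℝ Tᗮ j : E n)) Finset.univ
  rw [Finset.card_univ, Fintype.card_fin, ← nsmul_eq_mul, ← Nat.cast_smul_eq_nsmul ℝ] at h
  have h' := congrArg (Subtype.val : Subalgebra.center ℝ (Form n) → Form n) h
  have hβ : beta n - ∑ i, kahler (stdOrthonormalBasis ℝ T i : E n)
      (stdOrthonormalBasis ℝ T i : E n) =
      ((∑ j, kahlerSq (stdOrthonormalBasis ℝ Tᗮ j : E n) : Subalgebra.center ℝ (Form n)) :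
        Form n) := by
    rw [beta_eq_sum_kahler (adaptedBasis T), Fintype.sum_sum_type]
    simp [adaptedBasis_inl, adaptedBasis_inr, kahlerSq]
  rw [hβ, ← finrank_orthogonal, ← SubmonoidClass.coe_pow, h', normalForm_eq_prod]
  change _ = _ • ((_ : ℝ) • (_ : Form n))
  rw [smul_smul, inv_mul_cancel₀ (Nat.cast_ne_zero.2 (Nat.factorial_ne_zero _)), one_smul]

/-- The frame formula for the adapted basis, with `s` the set of normal directions. -/
theorem topCoeff_normalForm_mul (T : Submodule ℝ (E n)) (u : E n) (a : Form n) :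
    topCoeff n (normalForm Tᗮ * (beta n ^ (finrank ℝ T - 1) * (lower u * a))) =
      ((finrank ℝ T - 1).factorial : ℝ) * ∑ i, inner ℝ (stdOrthonormalBasis ℝ T i : E n) u *
        inner ℝ (stdOrthonormalBasis ℝ T i : E n) (xiVector a) := by
  classical
  have h := topCoeff_prod_mul_beta_pow_mul_lower_mul (adaptedBasis T)
    (Finset.univ.map Function.Embedding.inl) u a
  have hc : (Finset.univ.map (Function.Embedding.inl :
      Fin (finrank ℝ Tᗮ) ↪ Fin (finrank ℝ Tᗮ) ⊕ Fin (finrank ℝ T)))ᶜ =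
      Finset.univ.map Function.Embedding.inr := by
    ext (i | i) <;> simp
  rw [hc, Finset.card_map, Finset.card_univ, Fintype.card_fin, Finset.prod_map,
    Finset.sum_map] at h
  simp only [Function.Embedding.inl_apply, Function.Embedding.inr_apply, adaptedBasis_inl,
    adaptedBasis_inr] at h
  rw [← h, normalForm_eq_prod]
  simp only [mul_assoc]

end Super
-- Traces through Gram matrices, Jacobi's formula, smoothness of inverses.
namespace Super
open Module Matrix

section Trace

variable {F W ι : Type*} [NormedAddCommGroup F] [InnerProductSpace ℝ F] [FiniteDimensional ℝ F]
  [AddCommGroup W] [Module ℝ W] [Fintype ι] [DecidableEq ι]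

/-- If `M` is the coordinate matrix of `A` in an orthonormal basis, the Gram matrix is `MᵀM`, so `M
G⁻¹ Mᵀ = 1`. Inserting this identity into the trace rewrites it in the frame `A`. -/
theorem sum_stdOrthonormalBasis_eq_sum_gram_inv (A : ι → F) (hA : LinearIndependent ℝ A)
    (T : Submodule ℝ F) (hT : Submodule.span ℝ (Set.range A) = T) (B : F →ₗ[ℝ] F →ₗ[ℝ] W) :
    ∑ k, B (stdOrthonormalBasis ℝ T k : F) (stdOrthonormalBasis ℝ T k : F) =
      ∑ i, ∑ j, (gram ℝ A)⁻¹ i j • B (A i) (A j) := by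
  classical
  subst hT
  set T := Submodule.span ℝ (Set.range A) with hT
  have hcard : Fintype.card ι = Fintype.card (Fin (finrank ℝ T)) := by
    rw [Fintype.card_fin, hT, finrank_span_eq_card hA]
  let σ : ι ≃ Fin (finrank ℝ T) := Fintype.equivOfCardEq hcard
  let e : OrthonormalBasis ι ℝ T := (stdOrthonormalBasis ℝ T).reindex σ.symm
  let A' : ι → T := fun i => ⟨A i, Submodule.subset_span ⟨i, rfl⟩⟩
  let M : Matrix ι ι ℝ := Matrix.of fun k i => inner ℝ (e k) (A' i)
  have hA' (i : ι) : A i = ∑ k, M k i • (e k : F) := by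
    refine (congrArg (Subtype.val : T → F) (e.sum_repr' (A' i))).symm.trans ?_
    simp [M]
  have hG : gram ℝ A = Mᵀ * M := by
    ext i j
    rw [gram_apply, mul_apply]
    have : inner ℝ (A i) (A j) = inner ℝ (A' i) (A' j) := rfl
    rw [this, ← e.sum_inner_mul_inner]
    simp [M, real_inner_comm]
  have hdet : IsUnit M.det := by
    have h := (posDef_gram_of_linearIndependent (𝕜 := ℝ) hA).det_pos
    rw [hG, det_mul, det_transpose] at h
    exact isUnit_iff_ne_zero.2 fun h0 => by simp [h0] at h
  have hM : M * (gram ℝ A)⁻¹ * Mᵀ = 1 := by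
    rw [hG, Matrix.mul_inv_rev, ← mul_assoc, mul_nonsing_inv _ hdet, one_mul]
    exact nonsing_inv_mul _ (by rwa [det_transpose])
  calc ∑ k, B (stdOrthonormalBasis ℝ T k : F) (stdOrthonormalBasis ℝ T k : F)
      = ∑ k, B (e k : F) (e k : F) := by
        rw [← σ.sum_comp]
        simp [e]
    _ = ∑ k, ∑ l, (1 : Matrix ι ι ℝ) k l • B (e k : F) (e l : F) := by
        simp [one_apply]
    _ = ∑ k, ∑ l, ∑ j, ∑ i, (M k i * (gram ℝ A)⁻¹ i j * M l j) • B (e k : F) (e l : F) := by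
        simp_rw [← hM, mul_apply, Finset.sum_smul, Finset.sum_mul, transpose_apply, Finset.sum_smul]
    _ = ∑ i, ∑ j, (gram ℝ A)⁻¹ i j • B (A i) (A j) := by
        simp_rw [fun i j => congrArg₂ (fun u v => B u v) (hA' i) (hA' j), map_sum,
          LinearMap.sum_apply, map_smul, LinearMap.smul_apply, Finset.smul_sum, smul_smul]
        have h1 : ∀ f : ι → ι → ι → ι → W, ∑ k, ∑ l, ∑ j, ∑ i, f k l j i =
            ∑ i, ∑ j, ∑ l, ∑ k, f k l j i := by
          intro f
          rw [Finset.sum_comm]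
          simp_rw [Finset.sum_comm (s := (Finset.univ : Finset ι)) (t := Finset.univ)
            (f := fun k j => ∑ i, f k _ j i)]
          rw [Finset.sum_comm]
          simp_rw [Finset.sum_comm (s := (Finset.univ : Finset ι)) (t := Finset.univ)
            (f := fun k i => f k _ _ i)]
          simp_rw [Finset.sum_comm (s := (Finset.univ : Finset ι)) (t := Finset.univ)
            (f := fun l i => ∑ k, f k l _ i)]
          rw [Finset.sum_comm]
        rw [h1]
        refine Finset.sum_congr rfl fun i _ => Finset.sum_congr rfl fun j _ =>
          Finset.sum_congr rfl fun l _ => Finset.sum_congr rfl fun k _ => ?_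
        congr 1
        ring

end Trace

section Jacobi

variable {ι : Type*} [Fintype ι] [DecidableEq ι]

theorem hasDerivAt_det_one_add_smul (H : Matrix ι ι ℝ) :
    HasDerivAt (fun t : ℝ => (1 + t • H).det) H.trace 0 := by
  have h : (fun t : ℝ => (1 + t • H).det) = fun t =>
      1 + H.trace * t + (det (1 + (Polynomial.X : Polynomial ℝ) • H.map Polynomial.C)).divX.divX.eval t * t ^ 2 := by
    funext t
    exact det_one_add_smul t H
  rw [h]
  have h1 := ((hasDerivAt_id (0 : ℝ)).const_mul H.trace).const_add 1
  have h2 := ((Polynomial.hasDerivAt (det (1 + (Polynomial.X : Polynomial ℝ) •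
    H.map Polynomial.C)).divX.divX (0 : ℝ)).mul (hasDerivAt_pow 2 (0 : ℝ)))
  refine (h1.add h2).congr_deriv ?_
  simp

/-- Jacobi's formula along a differentiable curve of matrices. -/
theorem hasDerivAt_det {G : ℝ → Matrix ι ι ℝ} {G' : Matrix ι ι ℝ} {t : ℝ}
    (hG : ∀ i j, HasDerivAt (fun s => G s i j) (G' i j) t) (hdet : (G t).det ≠ 0) :
    HasDerivAt (fun s => (G s).det) ((G t).det * ((G t)⁻¹ * G').trace) t := by
  -- The Leibniz expansion shows that the derivative depends only on the value and velocity of the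
  -- curve, so the curve may be replaced by the line `G t + s • G'`, where the determinant of `1 + s
  -- • H` applies.
  have hmul (K : ℝ → Matrix ι ι ℝ) (K' : Matrix ι ι ℝ) (s : ℝ)
      (hK : ∀ i j, HasDerivAt (fun s => K s i j) (K' i j) s) :
      HasDerivAt (fun s => (K s).det) (∑ σ : Equiv.Perm ι, Equiv.Perm.sign σ •
        ∑ i, (∏ j ∈ Finset.univ.erase i, K s (σ j) j) • K' (σ i) i) s := by
    simp_rw [det_apply]
    exact HasDerivAt.fun_sum fun σ _ => (HasDerivAt.fun_finsetProd fun i _ => hK (σ i) i).const_smul _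
  have h1 := hmul G G' t hG
  have h2 := hmul (fun s => G t + s • G') G' 0 fun i j => by
    simpa using ((hasDerivAt_id (0 : ℝ)).mul_const (G' i j)).const_add (G t i j)
  have h3 : HasDerivAt (fun s : ℝ => (G t + s • G').det)
      ((G t).det * ((G t)⁻¹ * G').trace) 0 := by
    have h := (hasDerivAt_det_one_add_smul ((G t)⁻¹ * G')).const_mul (G t).det
    refine h.congr_of_eventuallyEq (Filter.Eventually.of_forall fun s => ?_)
    simp only
    rw [← det_mul, mul_add, mul_one, mul_smul_comm, ← mul_assoc,
      mul_nonsing_inv _ (isUnit_iff_ne_zero.2 hdet), one_mul]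
  simp only [zero_smul, add_zero] at h2
  rw [← h2.unique h3]
  exact h1

end Jacobi

section Smooth

variable {X ι : Type*} [NormedAddCommGroup X] [NormedSpace ℝ X] [Fintype ι] [DecidableEq ι]
  {k : ℕ∞ω} {s : Set X} {G : X → Matrix ι ι ℝ}

theorem contDiffOn_det (hG : ∀ i j, ContDiffOn ℝ k (fun x => G x i j) s) :
    ContDiffOn ℝ k (fun x => (G x).det) s := by
  simp_rw [det_apply]
  exact ContDiffOn.sum fun σ _ => (contDiffOn_prod fun i _ => hG _ _).const_smul _

/-- Cramer's rule writes the entries as quotients of determinants. -/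
theorem contDiffOn_inv (hG : ∀ i j, ContDiffOn ℝ k (fun x => G x i j) s)
    (hdet : ∀ x ∈ s, (G x).det ≠ 0) (i j : ι) : ContDiffOn ℝ k (fun x => (G x)⁻¹ i j) s := by
  have h : (fun x => (G x)⁻¹ i j) = fun x => ((G x).det)⁻¹ *
      ((G x).updateRow j (Pi.single i 1)).det := by
    funext x
    rw [inv_def, Matrix.smul_apply, adjugate_apply, Ring.inverse_eq_inv', smul_eq_mul]
  rw [h]
  refine ((contDiffOn_det hG).inv hdet).mul (contDiffOn_det fun a b => ?_)
  simp_rw [updateRow_apply]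
  split_ifs
  · exact contDiffOn_const
  · exact hG _ _

end Smooth

end Super
-- Parametrizations and the area formula for Hausdorff measure.
namespace Super
open Module Matrix MeasureTheory Filter Topology
open scoped ENNReal NNReal

variable {m n : ℕ}

/-- A `C²` parametrization `f : V → ℝⁿ` which has a linear left inverse `π`. -/
structure IsParam (V : Set (E m)) (f : E m → E n) (π : E n →L[ℝ] E m) : Prop where
  isOpen : IsOpen V
  contDiffOn : ContDiffOn ℝ 2 f V
  left_inv : ∀ y ∈ V, π (f y) = y

/-- The partial derivative `∂_i f`. -/
noncomputable def pd {W : Type*} [NormedAddCommGroup W] [NormedSpace ℝ W] (f : E m → W) (i : Fin m)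
    (y : E m) : W := fderiv ℝ f y (EuclideanSpace.single i 1)

/-- The first fundamental form of `f`. -/
noncomputable def metric (f : E m → E n) (y : E m) : Matrix (Fin m) (Fin m) ℝ :=
  gram ℝ fun i => pd f i y

/-- The area density of `f`. -/
noncomputable def jac (f : E m → E n) (y : E m) : ℝ := √(metric f y).det

theorem LipschitzOnWith.euclideanHausdorffMeasure_image_le {X Y : Type*} [MetricSpace X]
    [MeasurableSpace X] [BorelSpace X] [MetricSpace Y] [MeasurableSpace Y] [BorelSpace Y]
    {K : ℝ≥0} {f : X → Y} {s : Set X} (h : LipschitzOnWith K f s) (d : ℕ) :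
    μHE[d] (f '' s) ≤ (K : ℝ≥0∞) ^ d * μHE[d] s := by
  have := h.hausdorffMeasure_image_le (d := d) (Nat.cast_nonneg d)
  rw [ENNReal.rpow_natCast] at this
  rw [Measure.euclideanHausdorffMeasure_def, Measure.euclideanHausdorffMeasure_def,
    Measure.smul_apply, Measure.smul_apply, mul_smul_comm]
  gcongr

theorem det_gram_linearMap (S : E m →ₗ[ℝ] E m) :
    (gram ℝ fun i => S (EuclideanSpace.single i 1)).det = LinearMap.det S ^ 2 := by
  let b := EuclideanSpace.basisFun (Fin m) ℝ
  have hG : (gram ℝ fun i => S (EuclideanSpace.single i 1)) =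
      (LinearMap.toMatrix b.toBasis b.toBasis S)ᵀ * LinearMap.toMatrix b.toBasis b.toBasis S := by
    ext i j
    rw [gram_apply, mul_apply, PiLp.inner_apply]
    simp [LinearMap.toMatrix_apply, b, mul_comm]
  rw [hG, det_mul, det_transpose, LinearMap.det_toMatrix, ← pow_two]

/-- Identifying the range of `L` isometrically with `ℝᵐ` reduces to a square matrix, whose Gram
determinant is the square of its determinant. -/
theorem euclideanHausdorffMeasure_linear_image (L : E m →ₗ[ℝ] E n) (hL : Function.Injective L)
    (A : Set (E m)) :
    μHE[m] (L '' A) =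
      ENNReal.ofReal √(gram ℝ fun i => L (EuclideanSpace.single i 1)).det * volume A := by
  have hfr : finrank ℝ (LinearMap.range L) = m := by
    rw [LinearMap.finrank_range_of_inj hL, finrank_euclideanSpace_fin]
  let φ : LinearMap.range L ≃ₗᵢ[ℝ] E m :=
    ((stdOrthonormalBasis ℝ (LinearMap.range L)).reindex (finCongr hfr)).repr
  let S : E m →ₗ[ℝ] E m := φ.toLinearEquiv.toLinearMap ∘ₗ L.rangeRestrict
  have hS (x : E m) : ((φ.symm (S x) : LinearMap.range L) : E n) = L x := by simp [S]
  have hiso : Isometry fun y : E m => ((φ.symm y : LinearMap.range L) : E n) :=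
    isometry_subtype_coe.comp φ.symm.isometry
  have himg : L '' A = (fun y : E m => ((φ.symm y : LinearMap.range L) : E n)) '' (S '' A) := by
    rw [Set.image_image]
    exact Set.image_congr fun x _ => (hS x).symm
  rw [himg, hiso.euclideanHausdorffMeasure_image, EuclideanSpace.euclideanHausdorffMeasure_eq_volume,
    Measure.addHaar_image_linearMap]
  congr 2
  have hG : (gram ℝ fun i => L (EuclideanSpace.single i 1)) =
      gram ℝ fun i => S (EuclideanSpace.single i 1) := by
    ext i j
    rw [gram_apply, gram_apply, ← hS, ← hS]
    exact φ.symm.inner_map_map _ _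
  rw [hG, det_gram_linearMap, Real.sqrt_sq_eq_abs]

/-- By second countability countably many of the neighbourhoods suffice; made disjoint, they allow
the inequality to be summed with the same constant. -/
theorem measure_le_of_locally_le {X : Type*} [TopologicalSpace X] [SecondCountableTopology X]
    [MeasurableSpace X] [OpensMeasurableSpace X] {μ ν : Measure X} {V : Set X}
    {c : ℝ≥0∞} (h : ∀ y ∈ V, ∃ B ∈ 𝓝 y, ∀ A, MeasurableSet A → A ⊆ V → A ⊆ B → μ A ≤ c * ν A)
    {A : Set X} (hA : MeasurableSet A) (hAV : A ⊆ V) : μ A ≤ c * ν A := by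
  choose! B hB hBA using h
  have hBo : ∀ y ∈ V, interior (B y) ∈ 𝓝[V] y := fun y hy =>
    mem_nhdsWithin_of_mem_nhds (interior_mem_nhds.2 (hB y hy))
  obtain ⟨t, htV, htc, hcov⟩ := TopologicalSpace.countable_cover_nhdsWithin hBo
  rcases t.eq_empty_or_nonempty with rfl | hne
  · have : A = ∅ := by
      rw [← Set.subset_empty_iff]
      exact (hAV.trans hcov).trans (by simp)
    simp [this]
  obtain ⟨y, rfl⟩ := htc.exists_eq_range hne
  let D : ℕ → Set X := disjointed fun k => interior (B (y k))
  have hD : ∀ k, MeasurableSet (D k) :=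
    MeasurableSet.disjointed fun k => isOpen_interior.measurableSet
  have hU : A = ⋃ k, A ∩ D k := by
    rw [← Set.inter_iUnion, iUnion_disjointed, eq_comm, Set.inter_eq_left]
    exact (hAV.trans hcov).trans (by simp)
  have hdisj : Pairwise (Function.onFun Disjoint fun k => A ∩ D k) := fun i j hij =>
    ((disjoint_disjointed _) hij).mono Set.inter_subset_right Set.inter_subset_right
  rw [hU, measure_iUnion hdisj fun k => hA.inter (hD k),
    measure_iUnion hdisj fun k => hA.inter (hD k), ← ENNReal.tsum_mul_left]
  refine ENNReal.tsum_le_tsum fun k => hBA _ (htV ⟨k, rfl⟩) _ (hA.inter (hD k))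
    (Set.inter_subset_left.trans hAV) ?_
  exact (Set.inter_subset_right.trans (disjointed_subset _ _)).trans interior_subset

namespace IsParam

variable {V : Set (E m)} {f : E m → E n} {π : E n →L[ℝ] E m}

theorem contDiffAt (hf : IsParam V f π) {y : E m} (hy : y ∈ V) : ContDiffAt ℝ 2 f y :=
  hf.contDiffOn.contDiffAt (hf.isOpen.mem_nhds hy)

theorem hasStrictFDerivAt (hf : IsParam V f π) {y : E m} (hy : y ∈ V) :
    HasStrictFDerivAt f (fderiv ℝ f y) y :=
  (hf.contDiffAt hy).hasStrictFDerivAt (by norm_num)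

theorem π_fderiv (hf : IsParam V f π) {y : E m} (hy : y ∈ V) (v : E m) :
    π (fderiv ℝ f y v) = v := by
  have h1 : HasFDerivAt (fun y => π (f y)) (π ∘L fderiv ℝ f y) y :=
    π.hasFDerivAt.comp y (hf.hasStrictFDerivAt hy).hasFDerivAt
  have h2 : HasFDerivAt (fun y => π (f y)) (ContinuousLinearMap.id ℝ (E m)) y :=
    (hasFDerivAt_id y).congr_of_eventuallyEq
      (eventually_of_mem (hf.isOpen.mem_nhds hy) hf.left_inv)
  exact DFunLike.congr_fun (h1.unique h2) v

theorem fderiv_injective (hf : IsParam V f π) {y : E m} (hy : y ∈ V) :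
    Function.Injective (fderiv ℝ f y) :=
  Function.LeftInverse.injective (hf.π_fderiv hy)

theorem linearIndependent_pd (hf : IsParam V f π) {y : E m} (hy : y ∈ V) :
    LinearIndependent ℝ fun i => pd f i y := by
  have := (EuclideanSpace.basisFun (Fin m) ℝ).toBasis.linearIndependent.map'
    (fderiv ℝ f y : E m →ₗ[ℝ] E n) (LinearMap.ker_eq_bot.2 (hf.fderiv_injective hy))
  have h : (fun i => pd f i y) = ⇑(fderiv ℝ f y : E m →ₗ[ℝ] E n) ∘
      ⇑(EuclideanSpace.basisFun (Fin m) ℝ).toBasis := by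
    funext i
    simp [pd]
  rwa [h]

theorem det_metric_pos (hf : IsParam V f π) {y : E m} (hy : y ∈ V) : 0 < (metric f y).det :=
  (posDef_gram_of_linearIndependent (𝕜 := ℝ) (hf.linearIndependent_pd hy)).det_pos

theorem jac_pos (hf : IsParam V f π) {y : E m} (hy : y ∈ V) : 0 < jac f y :=
  Real.sqrt_pos.2 (hf.det_metric_pos hy)

theorem contDiffOn_pd (hf : IsParam V f π) (i : Fin m) : ContDiffOn ℝ 1 (pd f i) V := by
  have := hf.contDiffOn.fderiv_of_isOpen (m := 1) hf.isOpen (by norm_num)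
  exact this.clm_apply contDiffOn_const

theorem contDiffOn_metric (hf : IsParam V f π) (i j : Fin m) :
    ContDiffOn ℝ 1 (fun y => metric f y i j) V :=
  (hf.contDiffOn_pd i).inner ℝ (hf.contDiffOn_pd j)

theorem contDiffOn_det_metric (hf : IsParam V f π) :
    ContDiffOn ℝ 1 (fun y => (metric f y).det) V := 
  contDiffOn_det hf.contDiffOn_metric

theorem contDiffOn_jac (hf : IsParam V f π) : ContDiffOn ℝ 1 (jac f) V :=
  hf.contDiffOn_det_metric.sqrt fun _ hy => (hf.det_metric_pos hy).ne'

theorem contDiffOn_metric_inv (hf : IsParam V f π) (i j : Fin m) :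
    ContDiffOn ℝ 1 (fun y => (metric f y)⁻¹ i j) V :=
  contDiffOn_inv hf.contDiffOn_metric (fun _ hy => (hf.det_metric_pos hy).ne') i j

/-- Near `y₀` the map `f` is compared with its derivative `L`. Since `π` inverts both, `f ∘ π` and
`L ∘ π` carry `L(A)` and `f(A)` onto each other, and both are `r`-Lipschitz there. -/
theorem exists_nhds_area (hf : IsParam V f π) {y₀ : E m} (hy₀ : y₀ ∈ V) {r : ℝ≥0} (hr : 1 < r) :
    ∃ B ∈ 𝓝 y₀, ∀ A ⊆ B, A ⊆ V →
      μHE[m] (f '' A) ≤ (r : ℝ≥0∞) ^ m * (ENNReal.ofReal (jac f y₀) * volume A) ∧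
      ENNReal.ofReal (jac f y₀) * volume A ≤ (r : ℝ≥0∞) ^ m * μHE[m] (f '' A) := by
  set L := fderiv ℝ f y₀
  have hr0 : (0 : ℝ) < r := by positivity
  have hr' : (1 : ℝ) < r := by exact_mod_cast hr
  -- The two Lipschitz bounds need `1 + ε ≤ r` and `1 - ε = r⁻¹` respectively.
  set ε : ℝ := 1 - (r : ℝ)⁻¹ with hε
  have hε0 : 0 < ε := by rw [hε, sub_pos]; exact inv_lt_one_of_one_lt₀ hr'
  have hεr : 1 + ε ≤ r := by
    have : (r : ℝ) * (r : ℝ)⁻¹ = 1 := mul_inv_cancel₀ hr0.ne'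
    rw [hε]
    nlinarith [inv_pos.2 hr0, sq_nonneg ((r : ℝ) - 1)]
  -- Since `π` inverts `L`, `‖x - y‖ ≤ ‖π‖ ‖L x - L y‖`; this `c` makes the linearization error at
  -- most `ε ‖L x - L y‖`.
  set c : ℝ≥0 := ⟨ε / (‖π‖ + 1), by positivity⟩ with hc
  have hc0 : 0 < c := by
    rw [← NNReal.coe_pos]
    change 0 < ε / (‖π‖ + 1)
    positivity
  obtain ⟨s, hs, happ⟩ := (hf.hasStrictFDerivAt hy₀).approximates_deriv_on_nhds (Or.inr hc0)
  have hkey : ∀ x ∈ s, ∀ y ∈ s, ‖f x - f y - L (x - y)‖ ≤ ε * ‖L x - L y‖ := by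
    intro x hx y hy
    refine (happ x hx y hy).trans ?_
    have h1 : ‖x - y‖ ≤ ‖π‖ * ‖L x - L y‖ := by
      conv_lhs => rw [← hf.π_fderiv hy₀ (x - y)]
      rw [← map_sub]
      exact π.le_opNorm _
    calc (c : ℝ) * ‖x - y‖ = ε / (‖π‖ + 1) * ‖x - y‖ := rfl
      _ ≤ ε / (‖π‖ + 1) * ((‖π‖ + 1) * ‖L x - L y‖) := by
        gcongr
        refine h1.trans ?_
        gcongr
        linarith
      _ = ε * ‖L x - L y‖ := by field_simp
  refine ⟨s, hs, fun A hAs hAV => ?_⟩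
  have hL : μHE[m] (L '' A) = ENNReal.ofReal (jac f y₀) * volume A :=
    euclideanHausdorffMeasure_linear_image (L : E m →ₗ[ℝ] E n) (hf.fderiv_injective hy₀) A
  rw [← hL]
  constructor
  · have hlip : LipschitzOnWith r (fun z => f (π z)) (L '' A) := by
      refine LipschitzOnWith.of_dist_le_mul ?_
      rintro _ ⟨x, hx, rfl⟩ _ ⟨y, hy, rfl⟩
      simp only [L, hf.π_fderiv hy₀, dist_eq_norm]
      have h1 := hkey x (hAs hx) y (hAs hy)
      have h2 : f x - f y = (f x - f y - L (x - y)) + (L x - L y) := by rw [map_sub]; abel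
      calc ‖f x - f y‖ ≤ ‖f x - f y - L (x - y)‖ + ‖L x - L y‖ := by
            conv_lhs => rw [h2]
            exact norm_add_le _ _
        _ ≤ (1 + ε) * ‖L x - L y‖ := by linarith
        _ ≤ r * ‖L x - L y‖ := by gcongr
    have := LipschitzOnWith.euclideanHausdorffMeasure_image_le hlip m
    rwa [Set.image_image, Set.image_congr fun x _ => by rw [hf.π_fderiv hy₀]] at this
  · have hlip : LipschitzOnWith r (fun z => L (π z)) (f '' A) := by
      refine LipschitzOnWith.of_dist_le_mul ?_
      rintro _ ⟨x, hx, rfl⟩ _ ⟨y, hy, rfl⟩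
      simp only [hf.left_inv x (hAV hx), hf.left_inv y (hAV hy), dist_eq_norm]
      have h1 := hkey x (hAs hx) y (hAs hy)
      have h2 : L x - L y = (f x - f y) - (f x - f y - L (x - y)) := by rw [map_sub]; abel
      have h3 : ‖L x - L y‖ ≤ ‖f x - f y‖ + ε * ‖L x - L y‖ := by
        calc ‖L x - L y‖ ≤ ‖f x - f y‖ + ‖f x - f y - L (x - y)‖ := by
              conv_lhs => rw [h2]
              exact norm_sub_le _ _
          _ ≤ _ := by gcongr
      have h4 : (r : ℝ)⁻¹ * ‖L x - L y‖ ≤ ‖f x - f y‖ := by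
        rw [hε] at h3; linarith
      rwa [inv_mul_le_iff₀ hr0] at h4
    have := LipschitzOnWith.euclideanHausdorffMeasure_image_le hlip m
    rwa [Set.image_image, Set.image_congr fun x hx => by rw [hf.left_inv x (hAV hx)]] at this

/-- The area formula. -/
theorem map_restrict_image (hf : IsParam V f π) :
    (μHE[m].restrict (f '' V)).map π =
      (volume.withDensity fun y => ENNReal.ofReal (jac f y)).restrict V := by
  set lam := (volume : Measure (E m)).withDensity fun y => ENNReal.ofReal (jac f y) with hlam
  set ν := (μHE[m].restrict (f '' V)).map π with hν
  have hπ : Measurable π := π.continuous.measurable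
  have hνA {A : Set (E m)} (hA : MeasurableSet A) : ν A = μHE[m] (f '' (A ∩ V)) := by
    rw [hν, Measure.map_apply hπ hA, Measure.restrict_apply (hπ hA)]
    congr 1
    ext x
    constructor
    · rintro ⟨hx, y, hy, rfl⟩
      refine ⟨y, ⟨?_, hy⟩, rfl⟩
      rwa [Set.mem_preimage, hf.left_inv y hy] at hx
    · rintro ⟨y, ⟨hyA, hy⟩, rfl⟩
      refine ⟨?_, y, hy, rfl⟩
      rwa [Set.mem_preimage, hf.left_inv y hy]
  -- The exponent `m + 1` collects `m` factors from the Lipschitz comparison and one from the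
  -- oscillation of `jac f`.
  have hloc {r : ℝ≥0} (hr : 1 < r) : ∀ y ∈ V, ∃ B ∈ 𝓝 y, ∀ A, MeasurableSet A → A ⊆ V → A ⊆ B →
      ν A ≤ (r : ℝ≥0∞) ^ (m + 1) * lam A ∧ lam A ≤ (r : ℝ≥0∞) ^ (m + 1) * ν A := by
    intro y₀ hy₀
    obtain ⟨B, hB, hBA⟩ := hf.exists_nhds_area hy₀ hr
    have hcont : ContinuousAt (jac f) y₀ :=
      hf.contDiffOn_jac.continuousOn.continuousAt (hf.isOpen.mem_nhds hy₀)
    have hr' : (1 : ℝ) < r := by exact_mod_cast hr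
    have hJ := hf.jac_pos hy₀
    have h1 : ∀ᶠ y in 𝓝 y₀, jac f y < r * jac f y₀ :=
      hcont.eventually_lt continuousAt_const (by nlinarith)
    have h2 : ∀ᶠ y in 𝓝 y₀, jac f y₀ < r * jac f y :=
      continuousAt_const.eventually_lt (hcont.const_mul _) (by nlinarith)
    refine ⟨_, inter_mem hB (h1.and h2), fun A hA hAV hAB => ?_⟩
    obtain ⟨h3, h4⟩ := hBA A (fun y hy => (hAB hy).1) hAV
    have hlamA : lam A = ∫⁻ y in A, ENNReal.ofReal (jac f y) := withDensity_apply _ hA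
    have h5 : ENNReal.ofReal (jac f y₀) * volume A ≤ r * lam A := by
      rw [hlamA, ← lintegral_const_mul' _ _ ENNReal.coe_ne_top, ← setLIntegral_const]
      refine setLIntegral_mono' hA fun y hy => ?_
      rw [← ENNReal.ofReal_coe_nnreal, ← ENNReal.ofReal_mul (zero_le_one.trans hr'.le)]
      exact ENNReal.ofReal_le_ofReal (hAB hy).2.2.le
    have h6 : lam A ≤ r * (ENNReal.ofReal (jac f y₀) * volume A) := by
      rw [hlamA, ← mul_assoc, ← setLIntegral_const]
      refine setLIntegral_mono' hA fun y hy => ?_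
      rw [← ENNReal.ofReal_coe_nnreal, ← ENNReal.ofReal_mul (zero_le_one.trans hr'.le)]
      exact ENNReal.ofReal_le_ofReal (hAB hy).2.1.le
    rw [hνA hA, Set.inter_eq_left.2 hAV]
    constructor
    · refine h3.trans ?_
      rw [pow_succ, mul_assoc]
      gcongr
    · refine h6.trans ?_
      rw [pow_succ', mul_assoc]
      gcongr
  -- Let `r` decrease to `1`.
  have hlim (a b : ℝ≥0∞) (h : ∀ r : ℝ≥0, 1 < r → a ≤ (r : ℝ≥0∞) ^ (m + 1) * b) : a ≤ b := by
    have ht : Tendsto (fun r : ℝ≥0 => (r : ℝ≥0∞) ^ (m + 1) * b) (𝓝[>] 1) (𝓝 (1 * b)) := by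
      refine ENNReal.Tendsto.mul_const ?_ (Or.inl one_ne_zero)
      have : Continuous fun r : ℝ≥0 => (r : ℝ≥0∞) ^ (m + 1) :=
        (ENNReal.continuous_pow _).comp ENNReal.continuous_coe
      simpa using (this.tendsto 1).mono_left nhdsWithin_le_nhds
    rw [one_mul] at ht
    exact ge_of_tendsto ht (eventually_mem_nhdsWithin.mono h)
  ext A hA
  have hAV : MeasurableSet (A ∩ V) := hA.inter hf.isOpen.measurableSet
  have hνV : ν A = ν (A ∩ V) := by
    rw [hνA hA, hνA hAV, Set.inter_assoc, Set.inter_self]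
  rw [Measure.restrict_apply hA, hνV]
  apply le_antisymm <;> refine hlim _ _ fun r hr => ?_
  · exact measure_le_of_locally_le (fun y hy => (hloc hr y hy).imp fun B hB =>
      ⟨hB.1, fun A h1 h2 h3 => (hB.2 A h1 h2 h3).1⟩) hAV Set.inter_subset_right
  · exact measure_le_of_locally_le (fun y hy => (hloc hr y hy).imp fun B hB =>
      ⟨hB.1, fun A h1 h2 h3 => (hB.2 A h1 h2 h3).2⟩) hAV Set.inter_subset_right

end IsParam

end Super
-- Integration by parts and the Laplacian of a parametrization.
namespace Super
open Module Matrix MeasureTheory Filter Topology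

variable {m n : ℕ}

theorem pd_congr {W : Type*} [NormedAddCommGroup W] [NormedSpace ℝ W] {f g : E m → W} {y : E m}
    (h : f =ᶠ[𝓝 y] g) (j : Fin m) : pd f j y = pd g j y := by
  rw [pd, pd, h.fderiv_eq]

theorem pd_inner {f g : E m → E n} {y : E m} (hf : DifferentiableAt ℝ f y)
    (hg : DifferentiableAt ℝ g y) (j : Fin m) :
    pd (fun y => inner ℝ (f y) (g y)) j y =
      inner ℝ (f y) (pd g j y) + inner ℝ (pd f j y) (g y) :=
  fderiv_inner_apply ℝ hf hg _

/-- Extended by zero, `F` is a compactly supported `C¹` function on the whole space; integration by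
parts against the constant `1` then gives zero. -/
theorem integral_pd_eq_zero {V K : Set (E m)} (hV : IsOpen V) (hK : IsCompact K) (hKV : K ⊆ V)
    {F : E m → ℝ} (hF : ContDiffOn ℝ 1 F V) (hF0 : ∀ y ∈ V, y ∉ K → F y = 0) (j : Fin m) :
    IntegrableOn (pd F j) V ∧ ∫ y in V, pd F j y = 0 := by
  classical
  set F' := V.indicator F with hF'
  have heq : ∀ y ∈ V, F' =ᶠ[𝓝 y] F := fun y hy =>
    eventually_of_mem (hV.mem_nhds hy) fun z hz => Set.indicator_of_mem hz F
  have hsupp : Function.support F' ⊆ K := by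
    intro y hy
    by_contra h
    by_cases hyV : y ∈ V
    · exact hy (by rw [hF', Set.indicator_of_mem hyV, hF0 y hyV h])
    · exact hy (by rw [hF', Set.indicator_of_notMem hyV])
  have htsupp : tsupport F' ⊆ K := closure_minimal hsupp hK.isClosed
  have hcs : HasCompactSupport F' := hK.of_isClosed_subset (isClosed_tsupport _) htsupp
  have hC : ContDiff ℝ 1 F' := by
    refine contDiff_iff_contDiffAt.2 fun y => ?_
    by_cases hyV : y ∈ V
    · exact (hF.contDiffAt (hV.mem_nhds hyV)).congr_of_eventuallyEq (heq y hyV)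
    · have hyK : y ∉ tsupport F' := fun h => hyV (hKV (htsupp h))
      exact contDiffAt_const.congr_of_eventuallyEq (notMem_tsupport_iff_eventuallyEq.1 hyK)
  have hcont : Continuous fun y => pd F' j y := by
    have := hC.continuous_fderiv (by norm_num)
    exact this.clm_apply continuous_const
  have hcs' : HasCompactSupport fun y => pd F' j y :=
    (hcs.fderiv ℝ).comp_left (g := fun L : E m →L[ℝ] ℝ => L (EuclideanSpace.single j 1)) rfl
  have hint := hcont.integrable_of_hasCompactSupport (μ := volume) hcs'
  have h0 : ∫ y, pd F' j y = 0 := by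
    have h := integral_mul_fderiv_eq_neg_fderiv_mul_of_integrable (μ := (volume : Measure (E m)))
      (f := fun _ => (1 : ℝ)) (g := F') (v := EuclideanSpace.single j 1) (by simp)
      (by simpa [pd] using hint) (by simpa using hC.continuous.integrable_of_hasCompactSupport hcs)
      (by fun_prop)
      (fun y _ => hC.differentiable (by norm_num) y)
    simpa [pd] using h
  have hon : Set.EqOn (pd F j) (pd F' j) V := fun y hy => pd_congr (heq y hy).symm j
  refine ⟨(hint.integrableOn).congr_fun hon.symm hV.measurableSet, ?_⟩
  rw [setIntegral_congr_fun hV.measurableSet hon, setIntegral_eq_integral_of_forall_compl_eq_zero, h0]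
  intro y hy
  have hyK : y ∉ tsupport F' := fun h => hy (hKV (htsupp h))
  rw [pd, (notMem_tsupport_iff_eventuallyEq.1 hyK).fderiv_eq]
  simp

/-- The field `√g ∑ᵢ g^{ji} ∂ᵢ f`. -/
noncomputable def coframe (f : E m → E n) (j : Fin m) (y : E m) : E n :=
  ∑ i, (jac f y * (metric f y)⁻¹ j i) • pd f i y

/-- The Laplace–Beltrami operator of the induced metric applied to `f`, times the area density. -/
noncomputable def laplacian (f : E m → E n) (y : E m) : E n := ∑ j, pd (coframe f j) j y

theorem metric_symm (f : E m → E n) (y : E m) (i j : Fin m) : metric f y i j = metric f y j i := by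
  rw [metric, gram_apply, gram_apply, real_inner_comm]

theorem metric_inv_symm (f : E m → E n) (y : E m) (i j : Fin m) :
    (metric f y)⁻¹ i j = (metric f y)⁻¹ j i := by
  have h : (metric f y)ᵀ = metric f y := by
    ext i j; exact metric_symm f y j i
  conv_lhs => rw [← h, ← transpose_nonsing_inv, transpose_apply]

namespace IsParam

variable {V : Set (E m)} {f : E m → E n} {π : E n →L[ℝ] E m}

theorem contDiffOn_coframe (hf : IsParam V f π) (j : Fin m) : ContDiffOn ℝ 1 (coframe f j) V :=
  ContDiffOn.sum fun i _ => (hf.contDiffOn_jac.mul (hf.contDiffOn_metric_inv j i)).smul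
    (hf.contDiffOn_pd i)

theorem differentiableAt_coframe (hf : IsParam V f π) (j : Fin m) {y : E m} (hy : y ∈ V) :
    DifferentiableAt ℝ (coframe f j) y :=
  ((hf.contDiffOn_coframe j).contDiffAt (hf.isOpen.mem_nhds hy)).differentiableAt (by norm_num)

theorem differentiableAt_pd (hf : IsParam V f π) (j : Fin m) {y : E m} (hy : y ∈ V) :
    DifferentiableAt ℝ (pd f j) y :=
  ((hf.contDiffOn_pd j).contDiffAt (hf.isOpen.mem_nhds hy)).differentiableAt (by norm_num)

theorem continuousOn_laplacian (hf : IsParam V f π) : ContinuousOn (laplacian f) V :=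
  continuousOn_finsetSum _ fun j _ =>
    ((hf.contDiffOn_coframe j).continuousOn_fderiv_of_isOpen hf.isOpen (by norm_num)).clm_apply
      continuousOn_const

/-- The integrand is the coordinate divergence `∑ ∂_j ⟨coframe_j, Φ⟩`. -/
theorem integral_coframe_add_laplacian (hf : IsParam V f π) {K : Set (E m)} (hK : IsCompact K)
    (hKV : K ⊆ V) {Φ : E m → E n} (hΦ : ContDiffOn ℝ 1 Φ V) (hΦ0 : ∀ y ∈ V, y ∉ K → Φ y = 0) :
    ∫ y in V, ((∑ j, inner ℝ (coframe f j y) (pd Φ j y)) + inner ℝ (laplacian f y) (Φ y)) = 0 := by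
  have h (j : Fin m) := integral_pd_eq_zero hf.isOpen hK hKV ((hf.contDiffOn_coframe j).inner ℝ hΦ)
    (fun y hy hyK => by rw [hΦ0 y hy hyK, inner_zero_right]) j
  have hsum : ∫ y in V, ∑ j, pd (fun y => inner ℝ (coframe f j y) (Φ y)) j y = 0 := by
    rw [integral_finsetSum _ fun j _ => (h j).1, Finset.sum_eq_zero fun j _ => (h j).2]
  rw [← hsum]
  refine setIntegral_congr_fun hf.isOpen.measurableSet fun y hy => ?_
  simp only [laplacian, sum_inner, ← Finset.sum_add_distrib]
  refine Finset.sum_congr rfl fun j _ => ?_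
  rw [pd_inner (hf.differentiableAt_coframe j hy)
    ((hΦ.contDiffAt (hf.isOpen.mem_nhds hy)).differentiableAt (by norm_num))]

theorem inner_coframe_pd (hf : IsParam V f π) {y : E m} (hy : y ∈ V) (j k : Fin m) :
    inner ℝ (coframe f j y) (pd f k y) = if j = k then jac f y else 0 := by
  have h : ((metric f y)⁻¹ * metric f y) j k = (1 : Matrix (Fin m) (Fin m) ℝ) j k := by
    rw [nonsing_inv_mul _ (isUnit_iff_ne_zero.2 (hf.det_metric_pos hy).ne')]
  rw [mul_apply, one_apply] at h
  simp only [coframe, sum_inner, real_inner_smul_left, mul_assoc, ← Finset.mul_sum]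
  have h' : ∑ i, (metric f y)⁻¹ j i * inner ℝ (pd f i y) (pd f k y) = if j = k then 1 else 0 := h
  rw [h']
  split_ifs <;> simp

theorem pd_pd_comm (hf : IsParam V f π) {y : E m} (hy : y ∈ V) (j k : Fin m) :
    pd (pd f j) k y = pd (pd f k) j y := by
  have hs := (hf.contDiffAt hy).isSymmSndFDerivAt (by simp)
  have hd : DifferentiableAt ℝ (fderiv ℝ f) y :=
    ((hf.contDiffAt hy).fderiv_right (m := 1) (by norm_num)).differentiableAt (by norm_num)
  have h (j k : Fin m) : pd (pd f j) k y = fderiv ℝ (fderiv ℝ f) y (EuclideanSpace.single k 1)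
      (EuclideanSpace.single j 1) := by
    change fderiv ℝ (fun y => fderiv ℝ f y (EuclideanSpace.single j 1)) y _ = _
    rw [fderiv_clm_apply hd (differentiableAt_const _)]
    simp
  rw [h, h]
  exact hs _ _

/-- Jacobi's formula gives `∂_k √g = ½ √g tr(g⁻¹ ∂_k g)`. The two product-rule terms of `∂_k g` have
equal traces, which cancels the factor `½`. -/
theorem pd_jac (hf : IsParam V f π) {y : E m} (hy : y ∈ V) (k : Fin m) :
    pd (jac f) k y = ∑ j, inner ℝ (coframe f j y) (pd (pd f j) k y) := by
  set e : E m := EuclideanSpace.single k 1 with he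
  have hline {W : Type} [NormedAddCommGroup W] [NormedSpace ℝ W] {g : E m → W}
      (hg : DifferentiableAt ℝ g y) : HasDerivAt (fun s : ℝ => g (y + s • e)) (pd g k y) 0 := by
    have h1 : HasDerivAt (fun s : ℝ => y + s • e) e 0 := by
      simpa using ((hasDerivAt_id (0 : ℝ)).smul_const e).const_add y
    have h2 : HasFDerivAt g (fderiv ℝ g y) (y + (0 : ℝ) • e) := by simpa using hg.hasFDerivAt
    exact h2.comp_hasDerivAt 0 h1
  have hG (i j : Fin m) : HasDerivAt (fun s : ℝ => metric f (y + s • e) i j)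
      (inner ℝ (pd f i y) (pd (pd f j) k y) + inner ℝ (pd (pd f i) k y) (pd f j y)) 0 := by
    have h := hline ((hf.differentiableAt_pd i hy).inner ℝ (hf.differentiableAt_pd j hy))
    rwa [pd_inner (hf.differentiableAt_pd i hy) (hf.differentiableAt_pd j hy)] at h
  have hpos := hf.det_metric_pos hy
  have hdet := hasDerivAt_det (G := fun s => metric f (y + s • e)) (G' := of fun i j =>
    inner ℝ (pd f i y) (pd (pd f j) k y) + inner ℝ (pd (pd f i) k y) (pd f j y)) (t := 0) hG (by simpa using hpos.ne')
  have hsqrt := hdet.sqrt (by simpa using hpos.ne')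
  have hJ : HasDerivAt (fun s : ℝ => jac f (y + s • e)) (pd (jac f) k y) 0 :=
    hline ((hf.contDiffOn_jac.contDiffAt (hf.isOpen.mem_nhds hy)).differentiableAt (by norm_num))
  rw [hJ.unique hsqrt]
  simp only [zero_smul, add_zero]
  have hJ2 : jac f y * jac f y = (metric f y).det := Real.mul_self_sqrt hpos.le
  have hJpos := hf.jac_pos hy
  change _ / (2 * jac f y) = _
  rw [← hJ2, div_eq_iff (by positivity)]
  have htr : trace ((metric f y)⁻¹ * of fun i j =>
      (inner ℝ (pd f i y) (pd (pd f j) k y) + inner ℝ (pd (pd f i) k y) (pd f j y))) =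
      2 * ∑ j, ∑ i, (metric f y)⁻¹ j i * inner ℝ (pd f i y) (pd (pd f j) k y) := by
    simp only [trace, diag_apply, mul_apply, of_apply, mul_add, Finset.sum_add_distrib]
    rw [two_mul]
    congr 1
    rw [Finset.sum_comm]
    refine Finset.sum_congr rfl fun j _ => Finset.sum_congr rfl fun i _ => ?_
    rw [metric_inv_symm, real_inner_comm]
  rw [htr]
  simp only [coframe, sum_inner, real_inner_smul_left, mul_assoc, ← Finset.mul_sum]
  ring

/-- Differentiate `⟨coframe_j, ∂_k f⟩ = δ_jk √g` in direction `j` and sum over `j`. As second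
derivatives commute, the terms `⟨coframe_j, ∂_k ∂_j f⟩` add up to `∂_k √g` and cancel the right-hand
side. -/
theorem inner_laplacian_pd (hf : IsParam V f π) {y : E m} (hy : y ∈ V) (k : Fin m) :
    inner ℝ (laplacian f y) (pd f k y) = 0 := by
  have h (j : Fin m) : inner ℝ (pd (coframe f j) j y) (pd f k y) =
      (if j = k then pd (jac f) k y else 0) - inner ℝ (coframe f j y) (pd (pd f j) k y) := by
    have h1 := pd_inner (hf.differentiableAt_coframe j hy) (hf.differentiableAt_pd k hy) j
    have h2 : (fun y => inner ℝ (coframe f j y) (pd f k y)) =ᶠ[𝓝 y]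
        fun y => if j = k then jac f y else 0 :=
      eventually_of_mem (hf.isOpen.mem_nhds hy) fun z hz => hf.inner_coframe_pd hz j k
    rw [pd_congr h2, hf.pd_pd_comm hy k j] at h1
    rw [eq_sub_iff_add_eq', ← h1]
    split_ifs with hjk
    · rw [hjk]
    · simp [pd]
  rw [laplacian, sum_inner, Finset.sum_congr rfl fun j _ => h j, Finset.sum_sub_distrib,
    ← hf.pd_jac hy]
  simp

/-- As `ρ ∘ f = 0`, `dρ` kills the tangential field `coframe f j`; differentiating this in direction
`j` trades `∂_j coframe_j` for the Hessian of `ρ`. -/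
theorem fderiv_laplacian (hf : IsParam V f π) {y : E m} (hy : y ∈ V) {ρ : E n → ℝ}
    (hρ : ContDiffAt ℝ 2 ρ (f y)) (h0 : ∀ᶠ z in 𝓝 y, ρ (f z) = 0) :
    fderiv ℝ ρ (f y) (laplacian f y) = -(jac f y *
      ∑ i, ∑ j, (metric f y)⁻¹ i j • fderiv ℝ (fderiv ℝ ρ) (f y) (pd f i y) (pd f j y)) := by
  have hfc : ContinuousAt f y := (hf.contDiffAt hy).continuousAt
  have hρ' : ∀ᶠ z in 𝓝 y, DifferentiableAt ℝ ρ (f z) :=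
    hfc.eventually ((hρ.eventually (by norm_num)).mono fun z hz => hz.differentiableAt (by norm_num))
  have hV : ∀ᶠ z in 𝓝 y, z ∈ V := hf.isOpen.mem_nhds hy
  have h1 : ∀ᶠ z in 𝓝 y, ∀ v, fderiv ℝ ρ (f z) (fderiv ℝ f z v) = 0 := by
    filter_upwards [hρ', hV, h0.eventually_nhds] with z hz hzV hz0 v
    have hc : HasFDerivAt (fun z => ρ (f z)) (fderiv ℝ ρ (f z) ∘L fderiv ℝ f z) z :=
      hz.hasFDerivAt.comp z (hf.hasStrictFDerivAt hzV).hasFDerivAt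
    have hc0 : HasFDerivAt (fun z => ρ (f z)) (0 : E m →L[ℝ] ℝ) z :=
      (hasFDerivAt_const (0 : ℝ) z).congr_of_eventuallyEq hz0
    exact DFunLike.congr_fun (hc.unique hc0) v
  have h2 (j : Fin m) : (fun z => fderiv ℝ ρ (f z) (coframe f j z)) =ᶠ[𝓝 y] fun _ => 0 := by
    filter_upwards [h1] with z hz
    rw [coframe, map_sum]
    exact Finset.sum_eq_zero fun i _ => by rw [map_smul, pd, hz, smul_zero]
  have hd : DifferentiableAt ℝ (fderiv ℝ ρ) (f y) :=
    (hρ.fderiv_right (m := 1) (by norm_num)).differentiableAt (by norm_num)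
  have h3 (j : Fin m) : fderiv ℝ ρ (f y) (pd (coframe f j) j y) =
      -(fderiv ℝ (fderiv ℝ ρ) (f y) (pd f j y) (coframe f j y)) := by
    have hcomp : HasFDerivAt (fun z => fderiv ℝ ρ (f z))
        (fderiv ℝ (fderiv ℝ ρ) (f y) ∘L fderiv ℝ f y) y :=
      hd.hasFDerivAt.comp y (hf.hasStrictFDerivAt hy).hasFDerivAt
    have h4 := pd_congr (h2 j) j
    rw [pd, fderiv_clm_apply hcomp.differentiableAt (hf.differentiableAt_coframe j hy),
      hcomp.fderiv] at h4
    have h5 : fderiv ℝ ρ (f y) (pd (coframe f j) j y) +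
      fderiv ℝ (fderiv ℝ ρ) (f y) (pd f j y) (coframe f j y) = 0 := by
      simpa [pd] using h4
    linarith
  rw [laplacian, map_sum, Finset.sum_congr rfl fun j _ => h3 j, Finset.sum_neg_distrib, neg_inj,
    Finset.mul_sum]
  refine Finset.sum_congr rfl fun j _ => ?_
  rw [coframe, map_sum, Finset.mul_sum]
  refine Finset.sum_congr rfl fun i _ => ?_
  rw [map_smul, smul_eq_mul, smul_eq_mul, mul_assoc]

end IsParam

end Super
-- Charts of a submanifold and its tangent spaces.
namespace Super
open Module Matrix MeasureTheory Filter Topology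
open TopologicalSpace (Opens)

variable {m n : ℕ}

/-- A parametrization `f : V → M ∩ U` of an open piece of `M`. -/
structure IsChart (M U : Set (E n)) (V : Set (E m)) (f : E m → E n) (π : E n →L[ℝ] E m) : Prop
    extends IsParam V f π where
  isOpen_domain : IsOpen U
  image_eq : f '' V = M ∩ U

theorem two_le_infty : (2 : ℕ∞ω) ≤ ∞ :=
  WithTop.coe_le_coe.2 le_top

theorem linearIndependent_gradient {κ : Type*} [Fintype κ] {ρ : κ → E n → ℝ} {x : E n}
    (h : LinearIndependent ℝ fun j => fderiv ℝ (ρ j) x) :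
    LinearIndependent ℝ fun j => ∇ (ρ j) x := by
  rw [Fintype.linearIndependent_iff] at h ⊢
  intro c hc
  refine h c (ContinuousLinearMap.ext fun v => ?_)
  have := congrArg (fun u => inner ℝ u v) hc
  simpa [sum_inner, real_inner_smul_left, inner_gradient_left] using this

/-- The orthogonal projection `π` onto the complement of the gradients at `a`, together with the
defining functions, is a local coordinate system by the inverse function theorem. Its inverse on the
slice `ρ = 0` is a graph over that plane, so `π` is a linear left inverse. -/
theorem IsSubmanifold.exists_isChart {Ω : Opens (E n)} {M : Set (E n)} (hM : IsSubmanifold m Ω M)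
    (hmn : m ≤ n) {a : E n} (ha : a ∈ M) :
    ∃ (U : Set (E n)) (V : Set (E m)) (f : E m → E n) (π : E n →L[ℝ] E m),
      a ∈ U ∧ U ⊆ Ω ∧ IsChart M U V f π := by
  obtain ⟨U₀, ρ, hU₀, haU₀, hρ, hMU₀, hind⟩ := hM.exists_defining a ha
  set v : Fin (n - m) → E n := fun j => ∇ (ρ j) a
  have hv : LinearIndependent ℝ v := linearIndependent_gradient (hind a ⟨ha, haU₀⟩)
  set N := Submodule.span ℝ (Set.range v)
  have hNo : finrank ℝ Nᗮ = m := by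
    have h1 := N.finrank_add_finrank_orthogonal
    rw [finrank_euclideanSpace_fin, finrank_span_eq_card hv, Fintype.card_fin] at h1
    omega
  let φ : Nᗮ ≃ₗᵢ[ℝ] E m := ((stdOrthonormalBasis ℝ Nᗮ).reindex (finCongr hNo)).repr
  let π : E n →L[ℝ] E m := (φ.toContinuousLinearEquiv : Nᗮ →L[ℝ] E m) ∘L Nᗮ.orthogonalProjectionOnto
  let R : E n →L[ℝ] (Fin (n - m) → ℝ) := ContinuousLinearMap.pi fun j => fderiv ℝ (ρ j) a
  let D : E n →L[ℝ] E m × (Fin (n - m) → ℝ) := π.prod R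
  have hDinj : Function.Injective D := by
    rw [injective_iff_map_eq_zero]
    intro w hw
    have hπw : π w = 0 := congrArg Prod.fst hw
    have hRw : R w = 0 := congrArg Prod.snd hw
    have h1 : w ∈ Nᗮ := by
      rw [Submodule.mem_orthogonal]
      intro u hu
      induction hu using Submodule.span_induction with
      | mem u hu =>
        obtain ⟨j, rfl⟩ := hu
        rw [inner_gradient_left]
        exact congrFun hRw j
      | zero => simp
      | add x y _ _ hx hy => rw [inner_add_left, hx, hy, add_zero]
      | smul c x _ hx => rw [real_inner_smul_left, hx, mul_zero]
    have h2 : Nᗮ.orthogonalProjectionOnto w = 0 := φ.toContinuousLinearEquiv.map_eq_zero_iff.1 hπw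
    have h3 := Submodule.orthogonalProjectionOnto_mem_subspace_eq_self (K := Nᗮ) ⟨w, h1⟩
    rw [h2] at h3
    exact (congrArg Subtype.val h3).symm
  let D' : E n ≃L[ℝ] E m × (Fin (n - m) → ℝ) :=
    (LinearEquiv.ofInjectiveOfFinrankEq (D : E n →ₗ[ℝ] E m × (Fin (n - m) → ℝ)) hDinj (by
      rw [finrank_prod, finrank_euclideanSpace_fin, finrank_euclideanSpace_fin, finrank_fin_fun]
      omega)).toContinuousLinearEquiv
  set Ψ : E n → E m × (Fin (n - m) → ℝ) := fun x => (π x, fun j => ρ j x) with hΨdef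
  have hΨ : ContDiffAt ℝ 2 Ψ a := by
    refine (π.contDiff.contDiffAt).prodMk (contDiffAt_pi.2 fun j => ?_)
    exact ((hρ j).contDiffAt (hU₀.mem_nhds haU₀)).of_le two_le_infty
  have hΨD : HasFDerivAt Ψ (D' : E n →L[ℝ] E m × (Fin (n - m) → ℝ)) a := by
    have h1 : HasFDerivAt Ψ D a := by
      refine π.hasFDerivAt.prodMk (hasFDerivAt_pi.2 fun j => ?_)
      exact (((hρ j).contDiffAt (hU₀.mem_nhds haU₀)).differentiableAt (by simp)).hasFDerivAt
    exact h1
  let e := hΨ.toOpenPartialHomeomorph Ψ hΨD (by norm_num)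
  have hee : (e : E n → _) = Ψ := rfl
  have hinv : ContDiffAt ℝ 2 e.symm (Ψ a) := hΨ.to_localInverse hΨD (by norm_num)
  have hae : a ∈ e.source := hΨ.mem_toOpenPartialHomeomorph_source hΨD (by norm_num)
  -- The inverse function theorem gives regularity at `Ψ a` only; on `O` the inverse is `C²` at
  -- every point.
  obtain ⟨O, hO, hOo, haO⟩ := mem_nhds_iff.1 (hinv.eventually (by norm_num))
  have hMzero {x : E n} (hx : x ∈ U₀) : x ∈ M ↔ ∀ j, ρ j x = 0 := by
    have : x ∈ M ∩ U₀ ↔ x ∈ {x ∈ U₀ | ∀ j, ρ j x = 0} := by rw [hMU₀]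
    simpa [hx] using this
  refine ⟨(e.source ∩ e ⁻¹' O) ∩ (U₀ ∩ Ω),
    (fun y => (y, 0)) ⁻¹' ((e.target ∩ e.symm ⁻¹' (U₀ ∩ Ω)) ∩ O), fun y => e.symm (y, 0), π,
    ⟨⟨hae, haO⟩, haU₀, hM.subset ha⟩, fun x hx => hx.2.2, ?_⟩
  refine { isOpen := ?_, contDiffOn := ?_, left_inv := ?_, isOpen_domain := ?_, image_eq := ?_ }
  · refine IsOpen.preimage (by fun_prop) ?_
    exact (e.isOpen_inter_preimage_symm (hU₀.inter Ω.isOpen)).inter hOo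
  · intro y hy
    refine ContDiffAt.contDiffWithinAt ?_
    have h1 : ContDiffAt ℝ 2 e.symm (y, (0 : Fin (n - m) → ℝ)) := hO hy.2
    exact ContDiffAt.comp (𝕜 := ℝ) (f := fun y : E m => (y, (0 : Fin (n - m) → ℝ))) y h1
      (contDiff_id.prodMk contDiff_const).contDiffAt
  · intro y hy
    have h1 : Ψ (e.symm (y, 0)) = (y, 0) := e.right_inv hy.1.1
    exact congrArg Prod.fst h1
  · exact (e.isOpen_inter_preimage hOo).inter (hU₀.inter Ω.isOpen)
  · ext x
    constructor
    · rintro ⟨y, hy, rfl⟩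
      have h1 : Ψ (e.symm (y, 0)) = (y, 0) := e.right_inv hy.1.1
      have h2 : e.symm (y, 0) ∈ U₀ := hy.1.2.1
      refine ⟨(hMzero h2).2 fun j => congrFun (congrArg Prod.snd h1) j,
        ⟨e.map_target hy.1.1, ?_⟩, hy.1.2⟩
      rw [Set.mem_preimage, hee, h1]
      exact hy.2
    · rintro ⟨hxM, ⟨hxs, hxO⟩, hxU⟩
      have h1 : e x = (π x, 0) :=
        Prod.ext rfl (funext fun j => (hMzero hxU.1).1 hxM j)
      have h2 : e.symm (π x, 0) = x := by rw [← h1, e.left_inv hxs]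
      refine ⟨π x, ⟨⟨?_, ?_⟩, ?_⟩, h2⟩
      · change ((π x, 0) : E m × (Fin (n - m) → ℝ)) ∈ e.target
        rw [← h1]; exact e.map_source hxs
      · rw [Set.mem_preimage, h2]; exact hxU
      · change ((π x, 0) : E m × (Fin (n - m) → ℝ)) ∈ O
        rw [← h1]; exact hxO

namespace IsChart

variable {M U : Set (E n)} {V : Set (E m)} {f : E m → E n} {π : E n →L[ℝ] E m}

theorem map_mem (hf : IsChart M U V f π) {y : E m} (hy : y ∈ V) : f y ∈ M ∩ U :=
  hf.image_eq ▸ Set.mem_image_of_mem f hy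

theorem right_inv (hf : IsChart M U V f π) {x : E n} (hx : x ∈ M ∩ U) : f (π x) = x := by
  rw [← hf.image_eq] at hx
  obtain ⟨y, hy, rfl⟩ := hx
  rw [hf.left_inv y hy]

theorem π_mem (hf : IsChart M U V f π) {x : E n} (hx : x ∈ M ∩ U) : π x ∈ V := by
  rw [← hf.image_eq] at hx
  obtain ⟨y, hy, rfl⟩ := hx
  rwa [hf.left_inv y hy]

/-- Derivatives of `f` map into the tangent cone. Conversely `f ∘ π` is the identity on `M ∩ U`, so
a vector `v` of the cone satisfies `v = Df(π v)`. -/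
theorem tangentSpace_eq (hf : IsChart M U V f π) {y : E m} (hy : y ∈ V) :
    Submodule.span ℝ (Set.range fun i => pd f i y) = tangentSpace M (f y) := by
  have hfd := (hf.hasStrictFDerivAt hy).hasFDerivAt
  apply le_antisymm
  · rw [Submodule.span_le]
    rintro _ ⟨i, rfl⟩
    refine Submodule.subset_span (tangentConeAt_mono (s := f '' V) ?_ ?_)
    · rw [hf.image_eq]; exact Set.inter_subset_left
    · refine (hfd.hasFDerivWithinAt (s := V)).mapsTo_tangent_cone ?_
      rw [tangentConeAt_of_mem_nhds (hf.isOpen.mem_nhds hy)]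
      exact Set.mem_univ _
  · rw [tangentSpace, Submodule.span_le]
    intro v hv
    rw [← tangentConeAt_inter_nhds (hf.isOpen_domain.mem_nhds (hf.map_mem hy).2)] at hv
    have h1 : HasFDerivAt (fun x => f (π x) - x)
        (fderiv ℝ f y ∘L π - ContinuousLinearMap.id ℝ (E n)) (f y) := by
      refine HasFDerivAt.sub ?_ (hasFDerivAt_id _)
      refine HasFDerivAt.comp (f y) ?_ π.hasFDerivAt
      rwa [hf.left_inv y hy]
    have h2 := (h1.hasFDerivWithinAt (s := M ∩ U)).mapsTo_tangent_cone hv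
    have h3 := tangentConeAt_mono (t := {0}) (by
      rintro _ ⟨x, hx, rfl⟩
      simp [hf.right_inv hx]) h2
    -- The map `f ∘ π - id` sends `M ∩ U` to one point, whose tangent cone contains only zero.
    have h4 : fderiv ℝ f y (π v) - v = 0 := by
      refine tangentConeAt_subset_zero ?_ h3
      intro hacc
      have := (accPt_iff_nhds.1 hacc) Set.univ univ_mem
      obtain ⟨z, ⟨_, hz⟩, hz'⟩ := this
      simp only [hf.left_inv y hy, sub_self] at hz'
      exact hz' hz
    rw [SetLike.mem_coe, ← sub_eq_zero.1 h4, ← (EuclideanSpace.basisFun (Fin m) ℝ).sum_repr (π v),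
      map_sum]
    refine Submodule.sum_mem _ fun i _ => ?_
    rw [map_smul, EuclideanSpace.basisFun_apply]
    exact Submodule.smul_mem _ _ (Submodule.subset_span ⟨i, rfl⟩)

theorem finrank_tangentSpace (hf : IsChart M U V f π) {y : E m} (hy : y ∈ V) :
    finrank ℝ (tangentSpace M (f y)) = m := by
  rw [← hf.tangentSpace_eq hy, finrank_span_eq_card (hf.linearIndependent_pd hy), Fintype.card_fin]

theorem sum_tangentSpace (hf : IsChart M U V f π) {y : E m} (hy : y ∈ V) {W : Type*}
    [AddCommGroup W] [Module ℝ W] (B : E n →ₗ[ℝ] E n →ₗ[ℝ] W) :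
    ∑ k, B (stdOrthonormalBasis ℝ (tangentSpace M (f y)) k : E n)
      (stdOrthonormalBasis ℝ (tangentSpace M (f y)) k : E n) =
      ∑ i, ∑ j, (metric f y)⁻¹ i j • B (pd f i y) (pd f j y) :=
  sum_stdOrthonormalBasis_eq_sum_gram_inv _ (hf.linearIndependent_pd hy) _
    (hf.tangentSpace_eq hy) B

theorem tangentialTrace_eq (hf : IsChart M U V f π) {y : E m} (hy : y ∈ V)
    (B : E n →L[ℝ] E n →L[ℝ] ℝ) :
    tangentialTrace M (f y) B = ∑ i, ∑ j, (metric f y)⁻¹ i j • B (pd f i y) (pd f j y) :=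
  hf.sum_tangentSpace hy ((ContinuousLinearMap.coeLM ℝ) ∘ₗ (B : E n →ₗ[ℝ] E n →L[ℝ] ℝ))

end IsChart

end Super
-- Defining functions with orthonormal gradients.
namespace Super
open Module Matrix MeasureTheory Filter Topology InnerProductSpace
open TopologicalSpace (Opens)

variable {m n : ℕ}

section GramSchmidt

variable {X F κ : Type*} [NormedAddCommGroup X] [NormedSpace ℝ X] [NormedAddCommGroup F]
  [InnerProductSpace ℝ F] [LinearOrder κ] [LocallyFiniteOrderBot κ] [WellFoundedLT κ]
  {k : ℕ∞ω} {s : Set X} {v : X → κ → F}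

theorem contDiffOn_gramSchmidt (hv : ∀ j, ContDiffOn ℝ k (fun x => v x j) s)
    (hind : ∀ x ∈ s, LinearIndependent ℝ (v x)) (j : κ) :
    ContDiffOn ℝ k (fun x => gramSchmidt ℝ (v x) j) s := by
  induction j using WellFoundedLT.induction with
  | ind j ih =>
    have h : (fun x => gramSchmidt ℝ (v x) j) = fun x => v x j - ∑ i ∈ Finset.Iio j,
        (inner ℝ (gramSchmidt ℝ (v x) i) (v x j) / ‖gramSchmidt ℝ (v x) i‖ ^ 2) •
          gramSchmidt ℝ (v x) i := by
      funext x
      rw [eq_sub_iff_add_eq]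
      exact (gramSchmidt_def'' ℝ (v x) j).symm
    rw [h]
    refine (hv j).sub (ContDiffOn.sum fun i hi => ?_)
    have hi' := ih i (Finset.mem_Iio.1 hi)
    refine ContDiffOn.smul (((hi'.inner ℝ (hv j))).div (hi'.norm_sq ℝ) fun x hx => ?_) hi'
    exact pow_ne_zero 2 (norm_ne_zero_iff.2 (gramSchmidt_ne_zero i (hind x hx)))

theorem contDiffOn_gramSchmidtNormed (hv : ∀ j, ContDiffOn ℝ k (fun x => v x j) s)
    (hind : ∀ x ∈ s, LinearIndependent ℝ (v x)) (j : κ) :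
    ContDiffOn ℝ k (fun x => gramSchmidtNormed ℝ (v x) j) s := by
  have h := contDiffOn_gramSchmidt hv hind j
  have hne (x) (hx : x ∈ s) := gramSchmidt_ne_zero j (hind x hx)
  exact ((h.norm ℝ hne).inv fun x hx => norm_ne_zero_iff.2 (hne x hx)).smul h

end GramSchmidt

theorem contDiffOn_gradient {ρ : E n → ℝ} {U : Set (E n)} (hU : IsOpen U)
    (hρ : ContDiffOn ℝ ∞ ρ U) : ContDiffOn ℝ ∞ (fun x => ∇ ρ x) U := by
  rw [contDiffOn_euclidean]
  intro i
  have h : (fun x => (∇ ρ x) i) = fun x => fderiv ℝ ρ x (EuclideanSpace.single i 1) := by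
    funext x
    rw [← inner_gradient_left, EuclideanSpace.inner_single_right]
    simp
  rw [h]
  exact (hρ.fderiv_of_isOpen hU (by simp)).clm_apply contDiffOn_const

/-- Gram–Schmidt turns the gradients `v` into `w = A v` with `A` smooth and invertible. The
functions `∑ A_jk ρ_k` have the same zeros, and on `M` their gradients are `w`, because the
derivatives of `A` are multiplied by `ρ_k = 0`. -/
theorem IsSubmanifold.exists_isOrthonormalDefiningSystem {Ω : Opens (E n)} {M : Set (E n)}
    (hM : IsSubmanifold m Ω M) {a : E n} (ha : a ∈ M) :
    ∃ (U : Set (E n)) (ρ : Fin (n - m) → E n → ℝ), a ∈ U ∧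
      IsOrthonormalDefiningSystem m M U ρ := by
  obtain ⟨U₀, ρ, hU₀, haU₀, hρ, hMU₀, hind⟩ := hM.exists_defining a ha
  set v : E n → Fin (n - m) → E n := fun x j => ∇ (ρ j) x with hv
  have hvU₀ (j) : ContDiffOn ℝ ∞ (fun x => v x j) U₀ := contDiffOn_gradient hU₀ (hρ j)
  have hGU₀ (i j) : ContDiffOn ℝ ∞ (fun x => gram ℝ (v x) i j) U₀ := (hvU₀ i).inner ℝ (hvU₀ j)
  have hvind {x : E n} (hx : x ∈ M ∩ U₀) : LinearIndependent ℝ (v x) :=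
    linearIndependent_gradient (hind x hx)
  -- Off `M` the gradients may be dependent; this open set excludes such points and loses none of
  -- `M`.
  set U := U₀ ∩ (fun x => (gram ℝ (v x)).det) ⁻¹' {0}ᶜ with hU
  have hUo : IsOpen U := (contDiffOn_det hGU₀).continuousOn.isOpen_inter_preimage hU₀
    isOpen_compl_singleton
  have hUU₀ : U ⊆ U₀ := Set.inter_subset_left
  have hdet (x) (hx : x ∈ U) : (gram ℝ (v x)).det ≠ 0 := hx.2
  have hvU (x) (hx : x ∈ U) : LinearIndependent ℝ (v x) :=
    linearIndependent_of_det_gram_ne_zero (𝕜 := ℝ) (hdet x hx)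
  have hMU : M ∩ U = M ∩ U₀ := by
    refine Set.Subset.antisymm (Set.inter_subset_inter_right _ hUU₀) fun x hx => ⟨hx.1, hx.2, ?_⟩
    exact (det_gram_ne_zero_iff_linearIndependent (𝕜 := ℝ)).2 (hvind hx)
  set w : E n → Fin (n - m) → E n := fun x => gramSchmidtNormed ℝ (v x) with hw
  have hwU (j) : ContDiffOn ℝ ∞ (fun x => w x j) U :=
    contDiffOn_gramSchmidtNormed (fun j => (hvU₀ j).mono hUU₀) hvU j
  have hwon (x) (hx : x ∈ U) : Orthonormal ℝ (w x) := gramSchmidtNormed_orthonormal (hvU x hx)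
  -- The coefficients of `w` in the frame `v`, written through the Gram matrix so that smoothness is
  -- visible.
  set A : E n → Matrix (Fin (n - m)) (Fin (n - m)) ℝ := fun x =>
    (of fun j l => inner ℝ (w x j) (v x l)) * (gram ℝ (v x))⁻¹ with hA
  have hAU (j k) : ContDiffOn ℝ ∞ (fun x => A x j k) U := by
    simp only [hA, mul_apply, of_apply]
    exact ContDiffOn.sum fun l _ => ((hwU j).inner ℝ ((hvU₀ l).mono hUU₀)).mul
      (contDiffOn_inv (fun i j => (hGU₀ i j).mono hUU₀) hdet l k)
  have hwA (x) (hx : x ∈ U) (j) : w x j = ∑ k, A x j k • v x k := by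
    have hmem : w x j ∈ Submodule.span ℝ (Set.range (v x)) := by
      rw [← span_gramSchmidt ℝ (v x), ← span_gramSchmidtNormed_range]
      exact Submodule.subset_span ⟨j, rfl⟩
    obtain ⟨c, hc⟩ := (Submodule.mem_span_range_iff_exists_fun ℝ).1 hmem
    have hcA (k) : A x j k = c k := by
      have h1 : (fun l => inner ℝ (w x j) (v x l)) = c ᵥ* gram ℝ (v x) := by
        funext l
        rw [← hc, sum_inner]
        simp [vecMul, dotProduct, real_inner_smul_left]
      have h2 : A x j = (fun l => inner ℝ (w x j) (v x l)) ᵥ* (gram ℝ (v x))⁻¹ := by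
        funext k
        simp [hA, mul_apply, vecMul, dotProduct]
      rw [h2, h1, vecMul_vecMul, mul_nonsing_inv _ (isUnit_iff_ne_zero.2 (hdet x hx)), vecMul_one]
    simp_rw [hcA, hc]
  -- This is orthonormality of `w`; the right inverse of `A` it provides shows that the zero set is
  -- unchanged.
  have hAinv (x) (hx : x ∈ U) : A x * (gram ℝ (v x) * (A x)ᵀ) = 1 := by
    rw [← gram_eq_one_iff_orthonormal.2 (hwon x hx)]
    ext i j
    rw [gram_apply, hwA x hx i, hwA x hx j]
    simp only [sum_inner, inner_sum, real_inner_smul_left, real_inner_smul_right, mul_apply,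
      transpose_apply, gram_apply, Finset.mul_sum]
    rw [Finset.sum_comm]
    refine Finset.sum_congr rfl fun k _ => Finset.sum_congr rfl fun l _ => ?_
    ring
  have hMzero {x : E n} (hx : x ∈ U₀) : x ∈ M ↔ ∀ j, ρ j x = 0 := by
    have : x ∈ M ∩ U₀ ↔ x ∈ {x ∈ U₀ | ∀ j, ρ j x = 0} := by rw [hMU₀]
    simpa [hx] using this
  refine ⟨U, fun j x => ∑ k, A x j k * ρ k x, (hMU ▸ (⟨ha, haU₀⟩ : a ∈ M ∩ U₀) : a ∈ M ∩ U).2,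
    ⟨hUo, fun j => ?_, ?_, fun x hx => ?_⟩⟩
  · exact ContDiffOn.sum fun k _ => (hAU j k).mul ((hρ k).mono hUU₀)
  · ext x
    constructor
    · rintro ⟨hxM, hx⟩
      refine ⟨hx, fun j => Finset.sum_eq_zero fun k _ => ?_⟩
      rw [(hMzero (hUU₀ hx)).1 hxM, mul_zero]
    · rintro ⟨hx, h0⟩
      refine ⟨(hMzero (hUU₀ hx)).2 fun j => ?_, hx⟩
      have h1 : A x *ᵥ (fun k => ρ k x) = 0 := funext h0
      have h2 : (fun k => ρ k x) = 0 := by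
        rw [← one_mulVec fun k => ρ k x, ← mul_eq_one_comm.1 (hAinv x hx), ← mulVec_mulVec, h1,
          mulVec_zero]
      exact congrFun h2 j
  · have hgrad (j) : ∇ (fun x => ∑ k, A x j k * ρ k x) x = w x j := by
      refine ext_inner_right ℝ fun u => ?_
      have hd : HasFDerivAt (fun x => ∑ k, A x j k * ρ k x)
          (∑ k, (A x j k • fderiv ℝ (ρ k) x + ρ k x • fderiv ℝ (fun x => A x j k) x)) x := by
        refine HasFDerivAt.fun_sum fun k _ => HasFDerivAt.mul ?_ ?_
        · exact (((hAU j k).contDiffAt (hUo.mem_nhds hx.2)).differentiableAt (by simp)).hasFDerivAt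
        · exact (((hρ k).contDiffAt (hU₀.mem_nhds (hUU₀ hx.2))).differentiableAt
            (by simp)).hasFDerivAt
      have h0 := (hMzero (hUU₀ hx.2)).1 hx.1
      rw [inner_gradient_left, hd.fderiv, hwA x hx.2 j]
      simp [h0, sum_inner, real_inner_smul_left, hv, inner_gradient_left]
    simp only [hgrad]
    exact hwon x hx.2

end Super
-- Tangential divergence and integration over `M` in charts.
namespace Super
open Module Matrix MeasureTheory Filter Topology InnerProductSpace
open TopologicalSpace (Opens)

variable {m n : ℕ}

/-- The bilinear form `(u, v) ↦ ⟪DX(x) u, v⟫` of a vector field `X`. -/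
noncomputable def derivForm (X : E n → E n) (x : E n) : E n →L[ℝ] E n →L[ℝ] ℝ :=
  (innerSL ℝ) ∘L (fderiv ℝ X x)

theorem derivForm_apply (X : E n → E n) (x u v : E n) :
    derivForm X x u v = inner ℝ (fderiv ℝ X x u) v := rfl

/-- The tangential divergence of `X` along `M`. -/
noncomputable def tangentialDiv (M : Set (E n)) (X : E n → E n) (x : E n) : ℝ :=
  tangentialTrace M x (derivForm X x)

theorem continuous_bilinear {F G W : Type*} [NormedAddCommGroup F] [NormedSpace ℝ F]
    [FiniteDimensional ℝ F] [NormedAddCommGroup G] [NormedSpace ℝ G] [FiniteDimensional ℝ G]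
    [NormedAddCommGroup W] [NormedSpace ℝ W] (B : F →ₗ[ℝ] G →ₗ[ℝ] W) :
    Continuous fun p : F × G => B p.1 p.2 :=
  (LinearMap.toContinuousLinearMap
    ((LinearMap.toContinuousLinearMap (E := G) (F' := W)).toLinearMap ∘ₗ B)).continuous₂

namespace IsChart

variable {M U : Set (E n)} {V : Set (E m)} {f : E m → E n} {π : E n →L[ℝ] E m}
  {W : Type*} [NormedAddCommGroup W]

theorem continuousOn (hf : IsChart M U V f π) : ContinuousOn f V := hf.contDiffOn.continuousOn

theorem measurableSet (hf : IsChart M U V f π) : MeasurableSet (M ∩ U) := by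
  rw [← hf.image_eq]
  exact hf.isOpen.measurableSet.image_of_continuousOn_injOn hf.continuousOn
    fun y hy z hz hyz => by rw [← hf.left_inv y hy, ← hf.left_inv z hz, hyz]

theorem map_restrict (hf : IsChart M U V f π) :
    (μHE[m].restrict (M ∩ U)).map π =
      (volume.restrict V).withDensity fun y => ENNReal.ofReal (jac f y) := by
  rw [← hf.image_eq, hf.map_restrict_image, restrict_withDensity hf.isOpen.measurableSet]

theorem aemeasurable_jac (hf : IsChart M U V f π) :
    AEMeasurable (fun y => ENNReal.ofReal (jac f y)) (volume.restrict V) :=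
  (hf.contDiffOn_jac.continuousOn.aemeasurable hf.isOpen.measurableSet).ennreal_ofReal

theorem aestronglyMeasurable_map (hf : IsChart M U V f π) {g : E m → W} (hg : ContinuousOn g V) :
    AEStronglyMeasurable g ((μHE[m].restrict (M ∩ U)).map π) := by
  rw [hf.map_restrict, ← restrict_withDensity hf.isOpen.measurableSet]
  exact hg.aestronglyMeasurable hf.isOpen.measurableSet

variable [NormedSpace ℝ W]

/-- On `M ∩ U` one has `h = h ∘ f ∘ π`, a function of `π x`, so the pushforward form of the area
formula applies. -/
theorem setIntegral_eq (hf : IsChart M U V f π) {h : E n → W}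
    (hh : ContinuousOn (fun y => h (f y)) V) :
    ∫ x in M ∩ U, h x ∂μHE[m] = ∫ y in V, jac f y • h (f y) := by
  have h1 : ∫ x in M ∩ U, h x ∂μHE[m] = ∫ x in M ∩ U, h (f (π x)) ∂μHE[m] :=
    setIntegral_congr_fun hf.measurableSet fun x hx => by rw [hf.right_inv hx]
  rw [h1, ← integral_map (f := fun y => h (f y)) π.continuous.measurable.aemeasurable
    (hf.aestronglyMeasurable_map hh), hf.map_restrict,
    integral_withDensity_eq_integral_toReal_smul₀ hf.aemeasurable_jac
      (Eventually.of_forall fun _ => ENNReal.ofReal_lt_top)]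
  refine setIntegral_congr_fun hf.isOpen.measurableSet fun y hy => ?_
  simp only [ENNReal.toReal_ofReal (hf.jac_pos hy).le]

theorem integrableOn (hf : IsChart M U V f π) {h : E n → W}
    (hh : ContinuousOn (fun y => h (f y)) V)
    (hint : IntegrableOn (fun y => jac f y • h (f y)) V) : IntegrableOn h (M ∩ U) μHE[m] := by
  have h1 : IntegrableOn (fun x => h (f (π x))) (M ∩ U) μHE[m] := by
    have h2 := integrable_map_measure (hf.aestronglyMeasurable_map hh)
      π.continuous.measurable.aemeasurable
    refine h2.1 ?_
    rw [hf.map_restrict, integrable_withDensity_iff_integrable_smul₀' hf.aemeasurable_jac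
      (Eventually.of_forall fun _ => ENNReal.ofReal_lt_top)]
    refine IntegrableOn.congr_fun hint (fun y hy => ?_) hf.isOpen.measurableSet
    simp only [ENNReal.toReal_ofReal (hf.jac_pos hy).le]
  exact h1.congr_fun (fun x hx => by simp only [hf.right_inv hx]) hf.measurableSet

theorem restrict (hf : IsChart M U V f π) {V' : Set (E m)} (hV' : IsOpen V') :
    IsChart M (U ∩ π ⁻¹' V') (V ∩ V') f π where
  isOpen := hf.isOpen.inter hV'
  contDiffOn := hf.contDiffOn.mono Set.inter_subset_left
  left_inv y hy := hf.left_inv y hy.1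
  isOpen_domain := hf.isOpen_domain.inter (hV'.preimage π.continuous)
  image_eq := by
    ext x
    constructor
    · rintro ⟨y, ⟨hy, hy'⟩, rfl⟩
      refine ⟨(hf.map_mem hy).1, (hf.map_mem hy).2, ?_⟩
      rwa [Set.mem_preimage, hf.left_inv y hy]
    · rintro ⟨hxM, hxU, hx⟩
      exact ⟨π x, ⟨hf.π_mem ⟨hxM, hxU⟩, hx⟩, hf.right_inv ⟨hxM, hxU⟩⟩

theorem continuousOn_pd (hf : IsChart M U V f π) (i : Fin m) : ContinuousOn (pd f i) V :=
  (hf.contDiffOn_pd i).continuousOn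

/-- The chosen orthonormal bases need not vary continuously. The frame-free expression of
`normalForm_orthogonal`, written in the coordinate frame `∂_i f`, does. -/
theorem continuousOn_normalForm (hf : IsChart M U V f π) :
    ContinuousOn (fun y => normalForm (normalSpace M (f y))) V := by
  have hk : ContinuousOn (fun y => ((n - m).factorial : ℝ)⁻¹ •
      (beta n - ∑ i, ∑ j, (metric f y)⁻¹ i j • kahler (pd f i y) (pd f j y)) ^ (n - m)) V := by
    have hpow : Continuous fun a : Form n => a ^ (n - m) := by
      have hmul : Continuous fun p : Form n × Form n => p.1 * p.2 :=
        continuous_bilinear (LinearMap.mul ℝ (Form n))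
      induction n - m with
      | zero => simpa using continuous_const
      | succ k ih => simp only [pow_succ]; exact hmul.comp (ih.prodMk continuous_id)
    have hkahler : Continuous fun p : E n × E n => kahler p.1 p.2 :=
      continuous_bilinear (kahler (n := n))
    have hin : ContinuousOn (fun y => beta n - ∑ i, ∑ j,
        (metric f y)⁻¹ i j • kahler (pd f i y) (pd f j y)) V := by
      refine continuousOn_const.sub ?_
      refine continuousOn_finsetSum _ fun i _ => continuousOn_finsetSum _ fun j _ => ?_
      exact (hf.contDiffOn_metric_inv i j).continuousOn.smul
        (hkahler.comp_continuousOn ((hf.continuousOn_pd i).prodMk (hf.continuousOn_pd j)))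
    exact (hpow.comp_continuousOn hin).const_smul ((n - m).factorial : ℝ)⁻¹
  refine hk.congr fun y hy => ?_
  simp only [normalSpace]
  rw [normalForm_orthogonal, hf.sum_tangentSpace hy kahler, hf.finrank_tangentSpace hy]

theorem tangentialDiv_eq (hf : IsChart M U V f π) {X : E n → E n} (hX : ContDiff ℝ 1 X) {y : E m}
    (hy : y ∈ V) : jac f y * tangentialDiv M X (f y) =
      ∑ i, inner ℝ (coframe f i y) (pd (fun y => X (f y)) i y) := by
  rw [tangentialDiv, hf.tangentialTrace_eq hy, Finset.mul_sum]
  refine Finset.sum_congr rfl fun i _ => ?_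
  have hpd : pd (fun y => X (f y)) i y = fderiv ℝ X (f y) (pd f i y) := by
    have := ((hX.differentiable (by norm_num) (f y)).hasFDerivAt.comp y
      (hf.hasStrictFDerivAt hy).hasFDerivAt).fderiv
    exact DFunLike.congr_fun this _
  rw [hpd, coframe, sum_inner, Finset.mul_sum]
  refine Finset.sum_congr rfl fun j _ => ?_
  rw [real_inner_smul_left, derivForm_apply, real_inner_comm, smul_eq_mul, mul_assoc]

theorem continuousOn_tangentialDiv (hf : IsChart M U V f π) {X : E n → E n}
    (hX : ContDiff ℝ 1 X) : ContinuousOn (fun y => tangentialDiv M X (f y)) V := by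
  have h : ContinuousOn (fun y => ∑ i, ∑ j, (metric f y)⁻¹ i j •
      inner ℝ (fderiv ℝ X (f y) (pd f i y)) (pd f j y)) V := by
    refine continuousOn_finsetSum _ fun i _ => continuousOn_finsetSum _ fun j _ => ?_
    refine (hf.contDiffOn_metric_inv i j).continuousOn.smul (ContinuousOn.inner ?_ ?_)
    · exact ((hX.continuous_fderiv (by norm_num)).comp_continuousOn hf.continuousOn).clm_apply
        (hf.continuousOn_pd i)
    · exact hf.continuousOn_pd j
  exact h.congr fun y hy => hf.tangentialTrace_eq hy (derivForm X (f y))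

end IsChart

end Super
-- The derivative of the current as the first variation of area.
namespace Super
open Module Matrix MeasureTheory Filter Topology InnerProductSpace
open TopologicalSpace (Opens)

variable {m n : ℕ} {Ω : Opens (E n)} {M : Set (E n)}

/-- Near a point of `M`, the density is continuous on a compact ball in a chart; elsewhere in `Ω`
the closedness of `M` gives a neighbourhood of measure zero. This justifies evaluating the current
as an integral. -/
theorem IsSubmanifold.locallyIntegrableOn_normalForm (hM : IsSubmanifold m Ω M) (hmn : m ≤ n) :
    LocallyIntegrableOn (fun x => normalForm (normalSpace M x)) Ω (μHE[m].restrict M) := by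
  intro x hx
  by_cases hxM : x ∈ M
  · obtain ⟨U, V, f, π, hxU, -, hf⟩ := hM.exists_isChart hmn hxM
    obtain ⟨r, hr, hrV⟩ := Metric.nhds_basis_closedBall.mem_iff.1
      (hf.isOpen.mem_nhds (hf.π_mem ⟨hxM, hxU⟩))
    have hf' := hf.restrict (V' := Metric.ball (π x) r) Metric.isOpen_ball
    have hcont := hf.continuousOn_normalForm
    have hint : IntegrableOn (fun y => jac f y • normalForm (normalSpace M (f y)))
        (V ∩ Metric.ball (π x) r) := by
      refine IntegrableOn.mono_set (t := Metric.closedBall (π x) r) ?_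
        (Set.inter_subset_right.trans Metric.ball_subset_closedBall)
      have hs : ContinuousOn (fun y => jac f y • normalForm (normalSpace M (f y))) V :=
        ContinuousOn.smul hf.contDiffOn_jac.continuousOn hcont
      have hc : IsCompact (Metric.closedBall (π x) r) := isCompact_closedBall _ _
      exact ContinuousOn.integrableOn_compact hc (hs.mono hrV)
    have h := hf'.integrableOn (h := fun x => normalForm (normalSpace M x)) 
      (hcont.mono Set.inter_subset_left) hint
    refine ⟨U ∩ π ⁻¹' Metric.ball (π x) r, mem_nhdsWithin_of_mem_nhds
      (hf'.isOpen_domain.mem_nhds ⟨hxU, Metric.mem_ball_self hr⟩), ?_⟩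
    rw [IntegrableOn, Measure.restrict_restrict hf'.isOpen_domain.measurableSet, Set.inter_comm]
    exact h
  · have hxc : x ∈ (closure M)ᶜ := fun h => hxM (hM.closed ⟨h, hx⟩)
    refine ⟨(closure M)ᶜ, mem_nhdsWithin_of_mem_nhds
      (isClosed_closure.isOpen_compl.mem_nhds hxc), ?_⟩
    rw [IntegrableOn, Measure.restrict_restrict isClosed_closure.isOpen_compl.measurableSet,
      Set.disjoint_iff_inter_eq_empty.1
        ((Set.disjoint_compl_left_iff_subset.2 subset_closure)), Measure.restrict_empty]
    exact integrable_zero_measure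

theorem IsSubmanifold.measurableSet (hM : IsSubmanifold m Ω M) : MeasurableSet M := by
  have h : M = closure M ∩ Ω := Set.Subset.antisymm
    (fun x hx => ⟨subset_closure hx, hM.subset hx⟩) hM.closed
  rw [h]
  exact isClosed_closure.measurableSet.inter Ω.isOpen.measurableSet

theorem dTest_apply (ψ : 𝓓(Ω, Form n)) (x : E n) :
    dTest Ω ψ x = ∑ k, dx k * fderiv ℝ ψ x (EuclideanSpace.single k 1) := by
  have hd : DifferentiableAt ℝ ψ x := (ψ.contDiff.differentiable (by simp)) x
  rw [dTest, _root_.sum_apply]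
  have hsum (g : Fin n → 𝓓(Ω, Form n)) : (∑ k, g k) x = ∑ k, g k x := by
    induction (Finset.univ : Finset (Fin n)) using Finset.induction_on with
    | empty => rfl
    | insert a s ha ih => rw [Finset.sum_insert ha, Finset.sum_insert ha, ← ih]; rfl
  rw [hsum]
  refine Finset.sum_congr rfl fun k _ => ?_
  rw [← hd.lineDeriv_eq_fderiv]
  change dx k * (TestFunction.lineDerivCLM ℝ (EuclideanSpace.single k (1 : ℝ)) ψ : 𝓓(Ω, Form n)) x
    = _
  rw [TestFunction.lineDerivCLM_apply_of_le (by simp)]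

/-- The vector field formed by the `dξ` components of a test form. -/
noncomputable def xiField (φ : 𝓓(Ω, Form n)) (x : E n) : E n := xiVector (φ x)

theorem contDiff_xiField (φ : 𝓓(Ω, Form n)) : ContDiff ℝ ∞ (xiField φ) :=
  (LinearMap.toContinuousLinearMap (xiVector (n := n))).contDiff.comp φ.contDiff

theorem fderiv_xiField (φ : 𝓓(Ω, Form n)) (x v : E n) :
    fderiv ℝ (xiField φ) x v = xiVector (fderiv ℝ φ x v) := by
  have hd : DifferentiableAt ℝ φ x := (φ.contDiff.differentiable (by simp)) x
  have := ((LinearMap.toContinuousLinearMap (xiVector (n := n))).hasFDerivAt.comp x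
    hd.hasFDerivAt).fderiv
  exact DFunLike.congr_fun this v

theorem tsupport_xiField_subset (φ : 𝓓(Ω, Form n)) : tsupport (xiField φ) ⊆ tsupport φ :=
  closure_mono fun x hx h => hx (by rw [xiField, h, map_zero])

/-- The superform `∑ Xᵢ dξᵢ` of a smooth compactly supported vector field `X`. -/
noncomputable def testForm (X : E n → E n) (hX : ContDiff ℝ ∞ X) (hc : HasCompactSupport X)
    (hs : tsupport X ⊆ Ω) : 𝓓(Ω, Form n) :=
  ⟨fun x => ((J n).toLinearMap ∘ₗ (ExteriorAlgebra.ι ℝ ∘ₗ covector)) (X x),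
    (LinearMap.toContinuousLinearMap
      ((J n).toLinearMap ∘ₗ (ExteriorAlgebra.ι ℝ ∘ₗ covector))).contDiff.comp hX,
    hc.comp_left (map_zero _), (tsupport_comp_subset (map_zero _) X).trans hs⟩

theorem xiField_testForm (X : E n → E n) (hX : ContDiff ℝ ∞ X) (hc : HasCompactSupport X)
    (hs : tsupport X ⊆ Ω) : xiField (testForm X hX hc hs) = X := by
  funext x
  change xiVector (J n (ExteriorAlgebra.ι ℝ (covector (X x)))) = X x
  rw [← lower_eq_ι, xiVector_J_lower]

/-- The term `dx_k ∧ ∂_k ψ` contributes `∑_i ⟨e_i, ε_k⟩ ⟨e_i, ∂_k X⟩`, with `ε_k` the standard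
basis; summing over `k` produces the derivative of `X` along `e_i`. -/
theorem topCoeff_normalForm_mul_dTest {x : E n} (hfr : finrank ℝ (tangentSpace M x) = m)
    (ψ : 𝓓(Ω, Form n)) :
    topCoeff n (normalForm (normalSpace M x) * (beta n ^ (m - 1) * dTest Ω ψ x)) =
      ((m - 1).factorial : ℝ) * tangentialDiv M (xiField ψ) x := by
  rw [dTest_apply, Finset.mul_sum, Finset.mul_sum, map_sum]
  simp_rw [dx_eq_lower, ← hfr, normalSpace, topCoeff_normalForm_mul]
  rw [← Finset.mul_sum, Finset.sum_comm, tangentialDiv, tangentialTrace]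
  congr 1
  refine Finset.sum_congr rfl fun i _ => ?_
  set e : E n := (stdOrthonormalBasis ℝ (tangentSpace M x) i : E n)
  have he : e = ∑ k, e k • EuclideanSpace.single k (1 : ℝ) := by
    conv_lhs => rw [← (EuclideanSpace.basisFun (Fin n) ℝ).sum_repr e]
    simp
  rw [derivForm_apply, fderiv_xiField]
  conv_rhs => enter [2]; rw [he]
  simp only [map_sum, map_smul, sum_inner, real_inner_smul_left]
  refine Finset.sum_congr rfl fun k _ => ?_
  rw [EuclideanSpace.inner_single_right, real_inner_comm]
  simp

theorem IsSubmanifold.finrank_tangentSpace (hM : IsSubmanifold m Ω M) (hmn : m ≤ n) {x : E n}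
    (hx : x ∈ M) : finrank ℝ (tangentSpace M x) = m := by
  obtain ⟨U, V, f, π, hxU, -, hf⟩ := hM.exists_isChart hmn hx
  rw [← hf.right_inv ⟨hx, hxU⟩]
  exact hf.finrank_tangentSpace (hf.π_mem ⟨hx, hxU⟩)

/-- The minus sign is the degree sign of the `dξ` part of `φ`, the only part that enters. -/
theorem IsSubmanifold.d_wedge_apply (hM : IsSubmanifold m Ω M) (hmn : m ≤ n) (φ : 𝓓(Ω, Form n)) :
    ((superCurrent m Ω M).wedge (beta n ^ (m - 1))).d φ =
      -(((m - 1).factorial : ℝ) * ∫ x in M, tangentialDiv M (xiField φ) x ∂μHE[m]) := by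
  set ψ : 𝓓(Ω, Form n) := TestFunction.postcompCLM
    (LinearMap.toContinuousLinearMap (degreeSign n).toLinearMap) φ with hψ
  have hψφ : xiField ψ = fun x => -xiField φ x := by
    funext x
    exact xiVector_degreeSign (φ x)
  have h1 : ((superCurrent m Ω M).wedge (beta n ^ (m - 1))).d φ =
      ∫ x in M, topCoeff n (normalForm (normalSpace M x) * (beta n ^ (m - 1) * dTest Ω ψ x))
        ∂μHE[m] :=
    TestFunction.integralAgainstBilinCLM_eq_integral
      (hM.locallyIntegrableOn_normalForm hmn)
      (f := TestFunction.postcompCLM (wedgeLeft (beta n ^ (m - 1))) (dTest Ω ψ))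
  rw [h1, ← integral_const_mul, ← integral_neg]
  refine setIntegral_congr_fun hM.measurableSet fun x hx => ?_
  rw [topCoeff_normalForm_mul_dTest (hM.finrank_tangentSpace hmn hx), hψφ, ← mul_neg]
  congr 1
  rw [tangentialDiv, tangentialDiv, tangentialTrace, tangentialTrace, ← Finset.sum_neg_distrib]
  refine Finset.sum_congr rfl fun i _ => ?_
  rw [derivForm_apply, derivForm_apply, fderiv_fun_neg, _root_.neg_apply, inner_neg_left]

namespace IsChart

variable {U : Set (E n)} {V : Set (E m)} {f : E m → E n} {π : E n →L[ℝ] E m}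

/-- `M` is closed only in `Ω`, but the support of `X` lies inside `Ω`, so `M ∩ tsupport X` is still
compact. -/
theorem isCompact_image_tsupport (hf : IsChart M U V f π) (hM : IsSubmanifold m Ω M) (hU : U ⊆ Ω)
    {X : E n → E n} (hXc : HasCompactSupport X) (hXU : tsupport X ⊆ U) :
    IsCompact (π '' (M ∩ tsupport X)) ∧ π '' (M ∩ tsupport X) ⊆ V ∧
      ∀ y ∈ V, y ∉ π '' (M ∩ tsupport X) → X (f y) = 0 := by
  refine ⟨?_, ?_, fun y hy hyK => ?_⟩
  · have hK₀ : M ∩ tsupport X = closure M ∩ tsupport X :=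
      Set.Subset.antisymm (Set.inter_subset_inter_left _ subset_closure)
        fun x hx => ⟨hM.closed ⟨hx.1, hU (hXU hx.2)⟩, hx.2⟩
    refine IsCompact.image ?_ π.continuous
    rw [hK₀]
    exact hXc.isCompact.inter_left isClosed_closure
  · rintro _ ⟨x, hx, rfl⟩
    exact hf.π_mem ⟨hx.1, hXU hx.2⟩
  · by_contra h
    exact hyK ⟨f y, ⟨(hf.map_mem hy).1, subset_tsupport _ h⟩, hf.left_inv y hy⟩

theorem continuousOn_inner_laplacian (hf : IsChart M U V f π) {X : E n → E n}
    (hX : Continuous X) : ContinuousOn (fun y => inner ℝ (laplacian f y) (X (f y))) V :=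
  hf.continuousOn_laplacian.inner (hX.comp_continuousOn hf.continuousOn)

theorem integrableOn_inner_laplacian (hf : IsChart M U V f π) (hM : IsSubmanifold m Ω M)
    (hU : U ⊆ Ω) {X : E n → E n} (hX : Continuous X) (hXc : HasCompactSupport X)
    (hXU : tsupport X ⊆ U) :
    IntegrableOn (fun y => inner ℝ (laplacian f y) (X (f y))) V := by
  obtain ⟨hK, hKV, hΦ0⟩ := hf.isCompact_image_tsupport hM hU hXc hXU
  refine IntegrableOn.of_forall_sdiff_eq_zero
    (((hf.continuousOn_inner_laplacian hX).mono hKV).integrableOn_compact hK)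
    hf.isOpen.measurableSet fun y hy => ?_
  rw [hΦ0 y hy.1 hy.2, inner_zero_right]

theorem tangentialDiv_eq_zero {X : E n → E n} {x : E n} (hx : x ∉ tsupport X) :
    tangentialDiv M X x = 0 := by
  have h0 : fderiv ℝ X x = 0 := by
    rw [(notMem_tsupport_iff_eventuallyEq.1 hx).fderiv_eq]
    simp
  simp [tangentialDiv, tangentialTrace, derivForm_apply, h0]

/-- The first variation formula in a chart. -/
theorem integral_tangentialDiv (hf : IsChart M U V f π) (hM : IsSubmanifold m Ω M) (hU : U ⊆ Ω)
    {X : E n → E n} (hX : ContDiff ℝ 1 X) (hXc : HasCompactSupport X) (hXU : tsupport X ⊆ U) :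
    ∫ x in M, tangentialDiv M X x ∂μHE[m] = -∫ y in V, inner ℝ (laplacian f y) (X (f y)) := by
  obtain ⟨hK, hKV, hΦ0⟩ := hf.isCompact_image_tsupport hM hU hXc hXU
  have hΦ : ContDiffOn ℝ 1 (fun y => X (f y)) V :=
    hX.comp_contDiffOn (hf.contDiffOn.of_le (by norm_num))
  have h1 : ∫ x in M, tangentialDiv M X x ∂μHE[m] =
      ∫ x in M ∩ U, tangentialDiv M X x ∂μHE[m] :=
    setIntegral_eq_of_subset_of_forall_sdiff_eq_zero hM.measurableSet Set.inter_subset_left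
      fun x hx => tangentialDiv_eq_zero fun h => hx.2 ⟨hx.1, hXU h⟩
  have h2 := hf.integral_coframe_add_laplacian hK hKV hΦ hΦ0
  have hint := hf.integrableOn_inner_laplacian hM hU hX.continuous hXc hXU
  have hint' : IntegrableOn
      (fun y => ∑ j, inner ℝ (coframe f j y) (pd (fun y => X (f y)) j y)) V := by
    refine IntegrableOn.of_forall_sdiff_eq_zero (s := π '' (M ∩ tsupport X)) ?_
      hf.isOpen.measurableSet fun y hy => ?_
    · refine ContinuousOn.integrableOn_compact hK ?_
      refine continuousOn_finsetSum _ fun j _ => ContinuousOn.inner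
        ((hf.contDiffOn_coframe j).continuousOn.mono hKV) ?_
      exact ((hΦ.continuousOn_fderiv_of_isOpen hf.isOpen (by norm_num)).clm_apply
        continuousOn_const).mono hKV
    · refine Finset.sum_eq_zero fun j _ => ?_
      have h0 : (fun y => X (f y)) =ᶠ[𝓝 y] fun _ => 0 :=
        eventually_of_mem ((hf.isOpen.sdiff hK.isClosed).mem_nhds hy)
          fun z hz => hΦ0 z hz.1 hz.2
      rw [pd_congr h0]
      simp [pd]
  rw [integral_add hint' hint] at h2
  rw [h1, hf.setIntegral_eq (hf.continuousOn_tangentialDiv hX), ← eq_neg_of_add_eq_zero_left h2]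
  exact setIntegral_congr_fun hf.isOpen.measurableSet fun y hy => hf.tangentialDiv_eq hX hy

end IsChart

end Super
-- Vanishing first variation and minimality.
namespace Super
open Module Matrix MeasureTheory Filter Topology InnerProductSpace
open TopologicalSpace (Opens)
open scoped Manifold

variable {m n : ℕ} {Ω : Opens (E n)} {M : Set (E n)}

namespace IsChart

variable {U U' : Set (E n)} {V : Set (E m)} {f : E m → E n} {π : E n →L[ℝ] E m}
  {ρ : Fin (n - m) → E n → ℝ}

theorem eventually_eq_zero (hf : IsChart M U V f π) (hρ : IsOrthonormalDefiningSystem m M U' ρ)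
    {y : E m} (hy : y ∈ V) (hyU : f y ∈ U') (j : Fin (n - m)) : ∀ᶠ z in 𝓝 y, ρ j (f z) = 0 := by
  filter_upwards [hf.isOpen.mem_nhds hy,
    (hf.contDiffAt hy).continuousAt.preimage_mem_nhds (hρ.isOpen.mem_nhds hyU)] with z hz hzU
  have h : f z ∈ M ∩ U' := ⟨(hf.map_mem hz).1, hzU⟩
  rw [hρ.inter_eq] at h
  exact h.2 j

theorem inner_gradient_pd (hf : IsChart M U V f π) (hρ : IsOrthonormalDefiningSystem m M U' ρ)
    {y : E m} (hy : y ∈ V) (hyU : f y ∈ U') (j : Fin (n - m)) (k : Fin m) :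
    inner ℝ (∇ (ρ j) (f y)) (pd f k y) = 0 := by
  have hd : DifferentiableAt ℝ (ρ j) (f y) :=
    ((hρ.contDiffOn j).contDiffAt (hρ.isOpen.mem_nhds hyU)).differentiableAt (by simp)
  have h1 := hd.hasFDerivAt.comp y (hf.hasStrictFDerivAt hy).hasFDerivAt
  have h2 : HasFDerivAt (ρ j ∘ f) (0 : E m →L[ℝ] ℝ) y :=
    (hasFDerivAt_const (0 : ℝ) y).congr_of_eventuallyEq (hf.eventually_eq_zero hρ hy hyU j)
  rw [inner_gradient_left]
  exact DFunLike.congr_fun (h1.unique h2) _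

theorem inner_gradient_laplacian (hf : IsChart M U V f π)
    (hρ : IsOrthonormalDefiningSystem m M U' ρ) {y : E m} (hy : y ∈ V) (hyU : f y ∈ U')
    (j : Fin (n - m)) : inner ℝ (∇ (ρ j) (f y)) (laplacian f y) =
      -(jac f y * tangentialTrace M (f y) (fderiv ℝ (fderiv ℝ (ρ j)) (f y))) := by
  rw [inner_gradient_left, hf.tangentialTrace_eq hy]
  exact hf.fderiv_laplacian hy
    (((hρ.contDiffOn j).contDiffAt (hρ.isOpen.mem_nhds hyU)).of_le two_le_infty)
    (hf.eventually_eq_zero hρ hy hyU j)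

/-- The Laplacian is normal, the gradients form an orthonormal basis of the normal space, and the
components are `-√g H_j` with `√g > 0`. -/
theorem laplacian_eq_zero_iff (hf : IsChart M U V f π)
    (hρ : IsOrthonormalDefiningSystem m M U' ρ) {y : E m} (hy : y ∈ V) (hyU : f y ∈ U') :
    laplacian f y = 0 ↔
      ∑ j, tangentialTrace M (f y) (fderiv ℝ (fderiv ℝ (ρ j)) (f y)) • ∇ (ρ j) (f y) = 0 := by
  have hon := hρ.orthonormal (f y) ⟨(hf.map_mem hy).1, hyU⟩
  have hlap := hf.inner_gradient_laplacian hρ hy hyU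
  constructor
  · intro h
    refine Finset.sum_eq_zero fun j _ => ?_
    have hj := hlap j
    rw [h, inner_zero_right, eq_comm, neg_eq_zero, mul_eq_zero] at hj
    rw [hj.resolve_left (hf.jac_pos hy).ne', zero_smul]
  · intro h
    have h0 := Fintype.linearIndependent_iff.1 hon.linearIndependent _ h
    set T := Submodule.span ℝ (Set.range fun i => pd f i y) with hT
    have hTN : Submodule.span ℝ (Set.range fun j => ∇ (ρ j) (f y)) = Tᗮ := by
      refine Submodule.eq_of_le_of_finrank_eq ?_ ?_
      · rw [Submodule.span_le]
        rintro _ ⟨j, rfl⟩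
        rw [SetLike.mem_coe, Submodule.mem_orthogonal']
        intro u hu
        induction hu using Submodule.span_induction with
        | mem u hu =>
          obtain ⟨k, rfl⟩ := hu
          exact hf.inner_gradient_pd hρ hy hyU j k
        | zero => exact inner_zero_right _
        | add u v _ _ hu hv => rw [inner_add_right, hu, hv, add_zero]
        | smul c u _ hu => rw [real_inner_smul_right, hu, mul_zero]
      · rw [finrank_span_eq_card hon.linearIndependent, finrank_orthogonal, hT,
          finrank_span_eq_card (hf.linearIndependent_pd hy), Fintype.card_fin, Fintype.card_fin]
    have hmem : laplacian f y ∈ Tᗮ := by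
      rw [Submodule.mem_orthogonal']
      intro u hu
      induction hu using Submodule.span_induction with
      | mem u hu =>
        obtain ⟨k, rfl⟩ := hu
        exact hf.inner_laplacian_pd hy k
      | zero => exact inner_zero_right _
      | add u v _ _ hu hv => rw [inner_add_right, hu, hv, add_zero]
      | smul c u _ hu => rw [real_inner_smul_right, hu, mul_zero]
    have horth : ∀ u ∈ Tᗮ, inner ℝ u (laplacian f y) = 0 := by
      intro u hu
      rw [← hTN] at hu
      induction hu using Submodule.span_induction with
      | mem u hu =>
        obtain ⟨j, rfl⟩ := hu
        rw [hlap j, h0 j, mul_zero, neg_zero]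
      | zero => exact inner_zero_left _
      | add u v _ _ hu hv => rw [inner_add_left, hu, hv, add_zero]
      | smul c u _ hu => rw [real_inner_smul_left, hu, mul_zero]
    exact inner_self_eq_zero.1 (horth _ hmem)

theorem laplacian_eq_zero_of_isMinimal (hf : IsChart M U V f π)
    (hmin : IsMinimal m M) {y : E m} (hy : y ∈ V) : laplacian f y = 0 := by
  obtain ⟨U', ρ, hyU, hρ, h⟩ := hmin (f y) (hf.map_mem hy).1
  exact (hf.laplacian_eq_zero_iff hρ hy hyU).2 h.symm

/-- If the first variation of `M` vanishes, so does the Laplacian of the parametrization. -/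
theorem laplacian_eq_zero_of_integral_eq_zero (hf : IsChart M U V f π)
    (hM : IsSubmanifold m Ω M) (hU : U ⊆ Ω)
    (h : ∀ X : E n → E n, ContDiff ℝ ∞ X → HasCompactSupport X → tsupport X ⊆ Ω →
      ∫ x in M, tangentialDiv M X x ∂μHE[m] = 0) {y : E m} (hy : y ∈ V) : laplacian f y = 0 := by
  set w := laplacian f y with hw
  by_contra hw0
  have hopen : IsOpen (V ∩ (fun z => inner ℝ (laplacian f z) w) ⁻¹' Set.Ioi 0) :=
    (hf.continuousOn_laplacian.inner continuousOn_const).isOpen_inter_preimage hf.isOpen isOpen_Ioi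
  -- A bump supported here, times the constant vector `w`, makes the first-variation integrand
  -- nonnegative.
  have hO : U ∩ π ⁻¹' (V ∩ (fun z => inner ℝ (laplacian f z) w) ⁻¹' Set.Ioi 0) ∈ 𝓝 (f y) := by
    refine (hf.isOpen_domain.inter (hopen.preimage π.continuous)).mem_nhds ⟨(hf.map_mem hy).2, ?_⟩
    rw [Set.mem_preimage, hf.left_inv y hy]
    exact ⟨hy, real_inner_self_pos.2 hw0⟩
  obtain ⟨r, hr, hrO⟩ := Metric.nhds_basis_closedBall.mem_iff.1 hO
  let χ : ContDiffBump (f y) := ⟨r / 2, r, half_pos hr, half_lt_self hr⟩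
  let X : E n → E n := fun x => χ x • w
  have hX : ContDiff ℝ ∞ X := χ.contDiff.smul contDiff_const
  have hXs : tsupport X ⊆ Metric.closedBall (f y) r := by
    rw [← χ.tsupport_eq]
    exact tsupport_smul_subset_left _ _
  have hXc : HasCompactSupport X :=
    (isCompact_closedBall (f y) r).of_isClosed_subset (isClosed_tsupport _) hXs
  have hXU : tsupport X ⊆ U := fun x hx => (hrO (hXs hx)).1
  have h1 := hf.integral_tangentialDiv hM hU (hX.of_le (by simp)) hXc hXU
  rw [h X hX hXc (hXU.trans hU), eq_comm, neg_eq_zero] at h1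
  have hnonneg : ∀ z ∈ V, 0 ≤ inner ℝ (laplacian f z) (X (f z)) := by
    intro z hz
    simp only [X, real_inner_smul_right]
    by_cases hzr : f z ∈ Metric.closedBall (f y) r
    · have := (hrO hzr).2
      rw [Set.mem_preimage, hf.left_inv z hz] at this
      exact mul_nonneg χ.nonneg (le_of_lt this.2)
    · rw [χ.zero_of_le_dist (not_le.1 hzr).le, zero_mul]
  have hae := (setIntegral_eq_zero_iff_of_nonneg_ae
    ((ae_restrict_iff' hf.isOpen.measurableSet).2 (Eventually.of_forall hnonneg))
    (hf.integrableOn_inner_laplacian hM hU hX.continuous hXc hXU)).1 h1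
  -- Nonnegative with zero integral means zero almost everywhere, hence everywhere on `V` by
  -- continuity; at `y` the value is `⟨w, w⟩`.
  have heq := Measure.eqOn_open_of_ae_eq hae hf.isOpen
    (hf.continuousOn_inner_laplacian hX.continuous) continuousOn_const hy
  simp only [X, Pi.zero_apply, χ.one_of_mem_closedBall (Metric.mem_closedBall_self (half_pos hr).le),
    one_smul] at heq
  exact hw0 (inner_self_eq_zero.1 heq)

end IsChart

/-- A linear functional on test functions that vanishes locally is zero. -/
theorem eq_zero_of_locally_eq_zero {F : Type*} [NormedAddCommGroup F] [NormedSpace ℝ F]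
    (Λ : 𝓓(Ω, F) →ₗ[ℝ] ℝ)
    (h : ∀ a ∈ Ω, ∃ O : Set (E n), IsOpen O ∧ a ∈ O ∧ ∀ φ : 𝓓(Ω, F), tsupport φ ⊆ O → Λ φ = 0)
    (φ : 𝓓(Ω, F)) : Λ φ = 0 := by
  classical
  choose! O hO haO hΛ using h
  obtain ⟨p, hp⟩ := SmoothPartitionOfUnity.exists_isSubordinate 𝓘(ℝ, E n) (s := tsupport φ)
    (isClosed_tsupport _) (fun a : Ω => O a) (fun a => hO a a.2)
    fun x hx => Set.mem_iUnion.2 ⟨⟨x, φ.tsupport_subset hx⟩, haO x (φ.tsupport_subset hx)⟩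
  -- Only finitely many members of the partition meet the support of `φ`, so `φ` is a finite sum of
  -- localized pieces.
  have hfin := p.locallyFinite.finite_nonempty_inter_compact φ.hasCompactSupport.isCompact
  have hsub (i : Ω) : tsupport (fun x => p i x • φ x) ⊆ tsupport φ :=
    tsupport_smul_subset_right _ _
  let g (i : Ω) : 𝓓(Ω, F) := ⟨fun x => p i x • φ x,
    (contMDiff_iff_contDiff.1 (p i).contMDiff).smul φ.contDiff,
    φ.hasCompactSupport.of_isClosed_subset (isClosed_tsupport _) (hsub i),
    (hsub i).trans φ.tsupport_subset⟩
  have hg (i : Ω) : Λ (g i) = 0 :=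
    hΛ i i.2 (g i) ((tsupport_smul_subset_left _ _).trans (hp i))
  have hsum : φ = ∑ i ∈ hfin.toFinset, g i := by
    refine TestFunction.ext fun x => ?_
    have hev (s : Finset Ω) : (∑ i ∈ s, g i) x = ∑ i ∈ s, g i x := by
      induction s using Finset.induction_on with
      | empty => rfl
      | insert a s ha ih => rw [Finset.sum_insert ha, Finset.sum_insert ha, ← ih]; rfl
    rw [hev]
    change φ x = ∑ i ∈ hfin.toFinset, p i x • φ x
    by_cases hx : x ∈ tsupport φ
    · rw [← Finset.sum_smul, ← finsum_eq_sum_of_support_subset, p.sum_eq_one hx, one_smul]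
      intro i hi
      rw [Set.Finite.coe_toFinset]
      exact ⟨x, hi, hx⟩
    · rw [image_eq_zero_of_notMem_tsupport hx]
      simp
  rw [hsum, map_sum]
  exact Finset.sum_eq_zero fun i _ => hg i

/-- Localization is applied to the current, which is linear, rather than to the integral; then each
test form lives either in one chart or off `M`. -/
theorem IsSubmanifold.d_wedge_eq_zero (hM : IsSubmanifold m Ω M) (hmn : m ≤ n)
    (hmin : IsMinimal m M) (φ : 𝓓(Ω, Form n)) :
    ((superCurrent m Ω M).wedge (beta n ^ (m - 1))).d φ = 0 := by
  refine eq_zero_of_locally_eq_zero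
    (((superCurrent m Ω M).wedge (beta n ^ (m - 1))).d : 𝓓(Ω, Form n) →ₗ[ℝ] ℝ) (fun a ha => ?_) φ
  by_cases haM : a ∈ M
  · obtain ⟨U, V, f, π, haU, hUΩ, hf⟩ := hM.exists_isChart hmn haM
    refine ⟨U, hf.isOpen_domain, haU, fun φ hφ => (hM.d_wedge_apply hmn φ).trans ?_⟩
    have hs := tsupport_xiField_subset φ
    rw [hf.integral_tangentialDiv hM hUΩ ((contDiff_xiField φ).of_le (by simp))
      (φ.hasCompactSupport.of_isClosed_subset (isClosed_tsupport _) hs) (hs.trans hφ),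
      setIntegral_congr_fun hf.isOpen.measurableSet
        (g := fun _ => (0 : ℝ)) fun y hy => by
          simp only [hf.laplacian_eq_zero_of_isMinimal hmin hy, inner_zero_left]]
    simp
  · refine ⟨(closure M)ᶜ, isClosed_closure.isOpen_compl, fun h => haM (hM.closed ⟨h, ha⟩),
      fun φ hφ => (hM.d_wedge_apply hmn φ).trans ?_⟩
    rw [setIntegral_congr_fun hM.measurableSet (g := fun _ => (0 : ℝ)) fun x hx =>
      IsChart.tangentialDiv_eq_zero fun h =>
        hφ (tsupport_xiField_subset φ h) (subset_closure hx)]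
    simp

/-- Testing with `∑ X_i dξ_i` makes the first variation vanish for every `X`, as `(m-1)! ≠ 0`.
Minimality also asks for an orthonormal defining system, hence the existence result. -/
theorem IsSubmanifold.isMinimal_of_isClosed (hM : IsSubmanifold m Ω M) (hmn : m ≤ n)
    (h : ((superCurrent m Ω M).wedge (beta n ^ (m - 1))).IsClosed) : IsMinimal m M := by
  intro x hx
  obtain ⟨U, V, f, π, hxU, hUΩ, hf⟩ := hM.exists_isChart hmn hx
  obtain ⟨U', ρ, hxU', hρ⟩ := hM.exists_isOrthonormalDefiningSystem hx
  refine ⟨U', ρ, hxU', hρ, ?_⟩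
  have hy := hf.π_mem ⟨hx, hxU⟩
  have hfx := hf.right_inv ⟨hx, hxU⟩
  have hlap := hf.laplacian_eq_zero_of_integral_eq_zero hM hUΩ (fun X hX hXc hXs => by
    have h1 := hM.d_wedge_apply hmn (testForm X hX hXc hXs)
    rw [xiField_testForm, show ((superCurrent m Ω M).wedge (beta n ^ (m - 1))).d = 0 from h,
      _root_.zero_apply, eq_comm, neg_eq_zero, mul_eq_zero] at h1
    exact h1.resolve_left (Nat.cast_ne_zero.2 (Nat.factorial_ne_zero _))) hy
  have := (hf.laplacian_eq_zero_iff hρ hy (hfx.symm ▸ hxU')).1 hlap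
  rw [hfx] at this
  exact this.symm

end Super

theorem corollary5p2 (n m : ℕ) (hm : 1 ≤ m) (hmn : m ≤ n)
    (Ω : TopologicalSpace.Opens (Super.E n)) (M : Set (Super.E n))
    (hM : Super.IsSubmanifold m Ω M) :
    ((Super.superCurrent m Ω M).wedge (Super.beta n ^ (m - 1))).IsClosed ↔
      Super.IsMinimal m M :=
  ⟨hM.isMinimal_of_isClosed hmn, fun hmin =>
    ContinuousLinearMap.ext (hM.d_wedge_eq_zero hmn hmin)⟩
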